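/- Fix a finite set $Z\subset\mathbb R$ and complex numbers $(a_n)_{n\in Z}$ and, for each time step $h=\Delta t>0$, consider the finite difference operator $\mathsf D v(t)=\sum_{n\in Z}\frac{a_n}{h}\,v(t+nh)$, with phase shift function $q(\omega)=\frac1{2\pi i}\sum_{n\in Z}\frac{a_n}{h}e^{2\pi i n\omega h}$ and normalized phase shift function $q_0(\eta)=\frac1{2\pi i}\sum_{n\in Z}a_ne^{2\pi i n\eta}$, so that $q(\omega)=q_0(\omega h)/h$. Assume that $q_0$ is real-valued on $\mathbb R$. Let $\Omega_0\subset\mathbb R$ be an interval containing the origin on which $q_0$ is injective (for instance the largest one), put $\Omega=\Omega(h)=\{\omega:\omega h\in\Omega_0\}$, and let $q_0^{-1}:q_0(\Omega_0)\to\Omega_0$ and $q^{-1}:q(\Omega)\to\Omega$ be the inverses. With $\widehat f(\omega)=\int_{\mathbb R} e^{-2\pi i t\omega}f(t)\,dt$, the forward and inverse time dispersion transforms are $$\mathcal T(f)(t)=\int_\Omega e^{2\pi i t\omega}\widehat f(q(\omega))\,d\omega,\qquad \mathcal I(f)(t)=\int_{q(\Omega)}e^{2\pi i t\omega}\widehat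 f(q^{-1}(\omega))\,d\omega .$$ For $(x,\xi)\in\mathbb R^2$ the Gaussian wave packet is $\varphi_{(x,\xi)}(t)=(2/h)^{1/4}e^{2\pi i(t-x)\xi/h}e^{-\pi(t-x)^2/h}$. A family $u=u(h)\in L^2(\mathbb R)$, $h>0$, is microlocally small near $(x_1,\xi_1)$ if there is a neighborhood $U$ of $(x_1,\xi_1)$ such that for every $N$ one has $|(u(h),\varphi_{(x,\xi)})_{L^2(\mathbb R)}|=O(h^N)$ as $h\to0^+$, uniformly for $(x,\xi)\in U$; the semiclassical wavefront set $\mathrm{WF}_h(u)$ is the set of points $(x_1,\xi_1)$ near which $u$ is not microlocally small. Let $\chi(x,\xi)=(x/q_0'(\xi),q_0(\xi))$ and $\chi^{-1}(x,\xi)=(x\,q_0'(q_0^{-1}(\xi)),q_0^{-1}(\xi))$, i.e. $\chi:(tq_0'(\eta),\eta)\mapsto(t,q_0(\eta))$ and its inverse. Proposition. Let $x_0\in\mathbb R$. (i) If $\xi_0$ is an interior point of $\Omega_0$ and $q_0'(\xi_0)\neq0$, then $\mathcal I(\varphi_{(x_0,\xi_0)})\in L^2(\mathbb R)$ for every $h>0$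 and $$\mathrm{WF}_h(\mathcal I(\varphi_{(x_0,\xi_0)}))=\{\chi(x_0,\xi_0)\}=\{(x_0/q_0'(\xi_0),\,q_0(\xi_0))\}.$$ (ii) If $\xi_0=q_0(\eta_0)$ for an interior point $\eta_0$ of $\Omega_0$, then $\mathcal T(\varphi_{(x_0,\xi_0)})\in L^2(\mathbb R)$ for every $h>0$ and $$\mathrm{WF}_h(\mathcal T(\varphi_{(x_0,\xi_0)}))=\{\chi^{-1}(x_0,\xi_0)\}=\{(x_0\,q_0'(q_0^{-1}(\xi_0)),\,q_0^{-1}(\xi_0))\}.$$ -/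

import Mathlib

open scoped FourierTransform Topology ComplexConjugate
open MeasureTheory Set Filter

noncomputable section

namespace TimeDispersion

/-- A finite difference scheme `D v(t) = ∑ n ∈ Z, c n * v (t + n * Δt)`, `Z` a finite set of reals,
whose coefficients are `c n = a n / Δt` with `a n` independent of the step `Δt`. -/
structure Scheme where
  /-- the finite index set `Z` (usually integers or half-integers) -/
  nodes : Finset ℝ
  /-- the normalized coefficients `a n = c n * Δt` -/
  coeff : ℝ → ℂ

/-- The (a priori complex) phase shift function at step `h`:
`q(ω) = (2πi)⁻¹ ∑ c n * exp (2πi n ω h)` with `c n = a n / h`. -/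
def Scheme.phaseC (D : Scheme) (h ω : ℝ) : ℂ :=
  1 / (2 * Real.pi * Complex.I) *
    ∑ n ∈ D.nodes, D.coeff n / h * Complex.exp (2 * Real.pi * Complex.I * n * ω * h)

/-- The normalized phase shift function `q₀(η) = (2πi)⁻¹ ∑ a n * exp (2πi n η)`. -/
def Scheme.phaseC₀ (D : Scheme) (η : ℝ) : ℂ :=
  1 / (2 * Real.pi * Complex.I) *
    ∑ n ∈ D.nodes, D.coeff n * Complex.exp (2 * Real.pi * Complex.I * n * η)

/-- The standing assumption that the phase shift function is real-valued. -/
def Scheme.RealPhase (D : Scheme) : Prop := ∀ η : ℝ, (D.phaseC₀ η).im = 0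

/-- The phase shift function `q` at step `h`, as a real function. -/
def Scheme.q (D : Scheme) (h ω : ℝ) : ℝ := (D.phaseC h ω).re

/-- The normalized phase shift function `q₀`, as a real function. -/
def Scheme.q₀ (D : Scheme) (η : ℝ) : ℝ := (D.phaseC₀ η).re

theorem Scheme.phaseC_eq (D : Scheme) {h : ℝ} (ω : ℝ) :
    D.phaseC h ω = D.phaseC₀ (ω * h) / h := by
  simp only [Scheme.phaseC, Scheme.phaseC₀, mul_div_assoc, Finset.sum_div, Finset.mul_sum]
  refine Finset.sum_congr rfl fun n _ => ?_
  push_cast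
  rw [← mul_assoc _ (ω : ℂ) (h : ℂ)]
  ring

/-- `q(ω) = q₀(ω h) / h`. -/
theorem Scheme.q_eq (D : Scheme) {h : ℝ} (ω : ℝ) : D.q h ω = D.q₀ (ω * h) / h := by
  rw [Scheme.q, Scheme.q₀, D.phaseC_eq, Complex.div_ofReal_re]

/-- For a real-valued phase, `q` and `q₀` are the phase shift functions themselves. -/
theorem Scheme.RealPhase.coe_q₀ {D : Scheme} (hD : D.RealPhase) (η : ℝ) :
    (D.q₀ η : ℂ) = D.phaseC₀ η := by
  apply Complex.ext <;> simp [Scheme.q₀, hD η]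

theorem Scheme.RealPhase.coe_q {D : Scheme} (hD : D.RealPhase) (h ω : ℝ) :
    (D.q h ω : ℂ) = D.phaseC h ω := by
  rw [D.q_eq, D.phaseC_eq, Complex.ofReal_div, hD.coe_q₀]

/-- `Ω₀` is an interval containing the origin on which `q₀` is invertible onto its image. -/
structure Scheme.IsBand (D : Scheme) (Ω₀ : Set ℝ) : Prop where
  ordConnected : Ω₀.OrdConnected
  zero_mem : (0 : ℝ) ∈ Ω₀
  injOn : InjOn D.q₀ Ω₀

/-- The frequency set `Ω = Ω(h)`: `ω ∈ Ω` if and only if `ω h ∈ Ω₀`. -/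
def band (Ω₀ : Set ℝ) (h : ℝ) : Set ℝ := {ω | ω * h ∈ Ω₀}

/-- The inverse `q⁻¹ : q(Ω) → Ω`. -/
def Scheme.qInv (D : Scheme) (Ω₀ : Set ℝ) (h : ℝ) : ℝ → ℝ :=
  Function.invFunOn (D.q h) (band Ω₀ h)

/-- The inverse `q₀⁻¹ : q₀(Ω₀) → Ω₀`. -/
def Scheme.q₀Inv (D : Scheme) (Ω₀ : Set ℝ) : ℝ → ℝ := Function.invFunOn D.q₀ Ω₀

/-- The forward time dispersion transform
`T f (t) = ∫_Ω exp (2πi t ω) * f^(q ω) dω` at step `h`. -/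
def Scheme.FTDT (D : Scheme) (Ω₀ : Set ℝ) (h : ℝ) (f : ℝ → ℂ) (t : ℝ) : ℂ :=
  ∫ ω in band Ω₀ h, Complex.exp (2 * Real.pi * Complex.I * t * ω) * 𝓕 f (D.q h ω)

/-- The inverse time dispersion transform
`I f (t) = ∫_{q(Ω)} exp (2πi t ω) * f^(q⁻¹ ω) dω` at step `h`. -/
def Scheme.ITDT (D : Scheme) (Ω₀ : Set ℝ) (h : ℝ) (f : ℝ → ℂ) (t : ℝ) : ℂ :=
  ∫ ω in D.q h '' band Ω₀ h,
    Complex.exp (2 * Real.pi * Complex.I * t * ω) * 𝓕 f (D.qInv Ω₀ h ω)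

/-- The canonical map `χ (x, ξ) = (x / q₀'(ξ), q₀(ξ))`, i.e. `(t q₀'(η), η) ↦ (t, q₀(η))`. -/
def Scheme.chi (D : Scheme) (p : ℝ × ℝ) : ℝ × ℝ := (p.1 / deriv D.q₀ p.2, D.q₀ p.2)

/-- The inverse map `χ⁻¹ (x, ξ) = (x q₀'(q₀⁻¹(ξ)), q₀⁻¹(ξ))`,
i.e. `(t, q₀(η)) ↦ (t q₀'(η), η)`. -/
def Scheme.chiInv (D : Scheme) (Ω₀ : Set ℝ) (p : ℝ × ℝ) : ℝ × ℝ :=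
  (p.1 * deriv D.q₀ (D.q₀Inv Ω₀ p.2), D.q₀Inv Ω₀ p.2)

theorem Scheme.chi_apply (D : Scheme) (t : ℝ) {η : ℝ} (hη : deriv D.q₀ η ≠ 0) :
    D.chi (t * deriv D.q₀ η, η) = (t, D.q₀ η) := by
  simp [Scheme.chi, hη]

theorem Scheme.chiInv_apply {D : Scheme} {Ω₀ : Set ℝ} (hΩ : D.IsBand Ω₀) (t : ℝ) {η : ℝ}
    (hη : η ∈ Ω₀) : D.chiInv Ω₀ (t, D.q₀ η) = (t * deriv D.q₀ η, η) := by
  have h : D.q₀Inv Ω₀ (D.q₀ η) = η := hΩ.injOn.leftInvOn_invFunOn hη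
  simp [Scheme.chiInv, h]

/-- The Gaussian wave packet
`φ_{(x,ξ)}(t) = (2/h)^{1/4} exp (2πi (t - x) ξ / h) exp (-π (t - x)² / h)`. -/
def wavePacket (h : ℝ) (p : ℝ × ℝ) (t : ℝ) : ℂ :=
  (((2 / h) ^ (1 / 4 : ℝ) : ℝ) : ℂ) *
    Complex.exp (2 * Real.pi * Complex.I * (t - p.1) * p.2 / h) *
      Complex.exp (-Real.pi * (t - p.1) ^ 2 / h)

/-- The family `u h`, `h > 0`, is microlocally small near `p`: its `L²` inner products with the wave
packets at `p'` are `O(h^N)` as `h → 0⁺` for every `N`, uniformly for `p'` in one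
neighborhood of `p`. -/
def MicrolocallySmall (u : ℝ → ℝ → ℂ) (p : ℝ × ℝ) : Prop :=
  ∃ U ∈ 𝓝 p, ∀ N : ℕ, ∃ C : ℝ, ∀ᶠ h in 𝓝[>] (0 : ℝ), ∀ p' ∈ U,
    ‖∫ t : ℝ, u h t * conj (wavePacket h p' t)‖ ≤ C * h ^ N

/-- The semiclassical wavefront set of a family `u h ∈ L²(ℝ)`, `h > 0`. -/
def WFh (u : ℝ → ℝ → ℂ) : Set (ℝ × ℝ) := {p | ¬ MicrolocallySmall u p}

end TimeDispersion

end

/-!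
Both transforms superpose plane waves. By Parseval's formula, and after passing to the frequency
variable `η` of the band `Ω₀`, the pairing of either transform of the wave packet at `p₀ = (x₀, ξ₀)`
with the wave packet at `p = (x, ξ)` is `√(2 / h) ∫ A(η) exp (Φ(p, η) / h) dη` over `Ω₀`, where
`Φ(p, η) = 2πi (x r(η) - x₀ s(η)) - π ((s(η) - ξ₀)² + (r(η) - ξ)²)`. Here `(r, s, A)` is
`(q₀, id, |q₀'|)` for the inverse transform and `(id, q₀, 1)` for the forward transform, so both cases
follow from the single statement `WFh_eq_singleton`.

On the real line `Re Φ ≤ 0`. On the closure of the band it vanishes only at the frequency `η₀` with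
`s(η₀) = ξ₀`, and only if `ξ = r(η₀)`. In that case `Φ'(η₀) = 2πi (x r'(η₀) - x₀ s'(η₀))`. Hence there
is exactly one point `p` for which `η₀` is a critical point of the phase with `Re Φ = 0`, and it is
the image of `p₀` under the canonical map.

* At every other point, since `r` and `s` extend to entire functions, the contour of integration is
  moved off the real axis near `η₀` into the region `Re Φ < 0`. By compactness the resulting bound
  `exp (-ε / h)` is uniform for nearby `p`
  (`exists_eventually_norm_setIntegral_le_of_not_critical`).
* At the exceptional point, Laplace's method shows that the pairings have a nonzero limit in modulus
  (`tendsto_laplace_integral`). The domination needed is global, because one of `r`, `s` is the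
  identity and so `Re Φ ≤ -π (η - η₀)²`.

The band has to be bounded for the forward transform to be a convergent integral. It is, because
`q₀` is almost periodic and so cannot be injective on a half-line (`Scheme.IsBand.isBounded`). The
transforms lie in `L²` as inverse Fourier transforms of functions in `L¹ ∩ L²`
(`memLp_two_fourierInv`).
-/

namespace TimeDispersion

/-! ### Fourier inversion on `L¹ ∩ L²` and wave packets -/

theorem continuous_fourierInv {f : ℝ → ℂ} (hf : Integrable f) : Continuous (𝓕⁻ f) := by
  refine VectorFourier.fourierIntegral_continuous Real.continuous_fourierChar
    (L := -innerₗ ℝ) ?_ hf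
  simp only [LinearMap.neg_apply, innerₗ_apply_apply]
  fun_prop

/-- The multiplication formula: `𝓕⁻` is its own transpose on `L¹`. -/
theorem integral_fourierInv_mul {f g : ℝ → ℂ} (hf : Integrable f) (hg : Integrable g) :
    ∫ t, 𝓕⁻ f t * g t = ∫ ω, f ω * 𝓕⁻ g ω := by
  have h := VectorFourier.integral_fourierIntegral_smul_eq_flip (L := -innerₗ ℝ)
    Real.continuous_fourierChar
    (by simp only [LinearMap.neg_apply, innerₗ_apply_apply]; fun_prop) hf hg
  have e : (-innerₗ ℝ : ℝ →ₗ[ℝ] ℝ →ₗ[ℝ] ℝ).flip = -innerₗ ℝ := by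
    ext; simp
  rw [e] at h
  exact h

/-- The pointwise inverse Fourier transform of a function in `L¹ ∩ L²` lies in `L²`: as a tempered
distribution it agrees with the `L²` inverse Fourier transform. -/
theorem memLp_two_fourierInv {f : ℝ → ℂ} (hf1 : Integrable f) (hf2 : MemLp f 2 volume) :
    MemLp (𝓕⁻ f) 2 volume := by
  set G : Lp ℂ 2 (volume : Measure ℝ) := 𝓕⁻ (hf2.toLp f) with hG
  have key : 𝓕⁻ f =ᵐ[volume] G := by
    refine ae_eq_of_integral_contDiff_smul_eq (continuous_fourierInv hf1).locallyIntegrable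
      ((Lp.memLp G).locallyIntegrable (by norm_num)) fun g hg hgc => ?_
    have h₁ : HasCompactSupport (fun x => (g x : ℂ)) := hgc.comp_left (g := Complex.ofReal) rfl
    have h₂ : ContDiff ℝ (⊤ : ℕ∞) (fun x => (g x : ℂ)) := Complex.ofRealCLM.contDiff.comp hg
    set φ : SchwartzMap ℝ ℂ := h₁.toSchwartzMap h₂
    have h := DFunLike.congr_fun (Lp.fourierInv_toTemperedDistribution_eq (hf2.toLp f)) φ
    rw [TemperedDistribution.fourierInv_apply, Lp.toTemperedDistribution_apply,
      Lp.toTemperedDistribution_apply] at h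
    have h3 : ∫ x, g x • (𝓕⁻ f) x = ∫ ω, (𝓕⁻ φ) ω • f ω := by
      have h4 := integral_fourierInv_mul hf1 φ.integrable
      calc _ = ∫ x, (𝓕⁻ f) x * φ x := by
            refine integral_congr_ae (Eventually.of_forall fun x => ?_)
            simp [φ, mul_comm]
        _ = _ := by
            rw [h4]
            refine integral_congr_ae (Eventually.of_forall fun x => ?_)
            simp only [smul_eq_mul, SchwartzMap.fourierInv_coe, mul_comm]
    rw [h3]
    calc _ = ∫ x, (𝓕⁻ φ) x • (hf2.toLp f) x := by
          refine integral_congr_ae ?_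
          filter_upwards [hf2.coeFn_toLp] with x hx
          rw [hx]
      _ = _ := h
  exact (memLp_congr_ae key).mpr (Lp.memLp G)

/-- The Fourier transform of a wave packet is again a Gaussian; the prefactor is `(2 h) ^ (1 / 4)`. -/
theorem fourier_wavePacket {h : ℝ} (hh : 0 < h) (p : ℝ × ℝ) (ω : ℝ) :
    𝓕 (wavePacket h p) ω = (((2 / h) ^ (1 / 4 : ℝ) * h ^ (1 / 2 : ℝ) : ℝ) : ℂ) *
      Complex.exp (-2 * Real.pi * Complex.I * p.1 * ω - Real.pi * (h * ω - p.2) ^ 2 / h) := by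
  have hh' : (h : ℂ) ≠ 0 := by exact_mod_cast hh.ne'
  set c : ℂ := ((((2 / h) ^ (1 / 4 : ℝ) : ℝ) : ℂ) *
      Complex.exp (-2 * Real.pi * Complex.I * p.1 * p.2 / h - Real.pi * p.1 ^ 2 / h)) with hc
  have e : wavePacket h p =
      fun x : ℝ => c • Complex.exp (-Real.pi * (1 / h : ℂ) * x ^ 2 +
        2 * Real.pi * (Complex.I * p.2 / h + p.1 / h) * x) := by
    ext t
    simp only [wavePacket, smul_eq_mul, hc]
    rw [mul_assoc, mul_assoc (Complex.ofReal _), ← Complex.exp_add, ← Complex.exp_add]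
    congr 2
    field_simp
    ring
  have hb : 0 < (1 / h : ℂ).re := by
    rw [← Complex.ofReal_one, ← Complex.ofReal_div, Complex.ofReal_re]; positivity
  have hroot : 1 / (1 / h : ℂ) ^ (1 / 2 : ℂ) = ((h ^ (1 / 2 : ℝ) : ℝ) : ℂ) := by
    have h2 : (1 / 2 : ℂ) = ((1 / 2 : ℝ) : ℂ) := by norm_num
    have h1 : (1 / h : ℂ) = ((1 / h : ℝ) : ℂ) := by norm_num
    rw [h2, h1, ← Complex.ofReal_cpow (by positivity), one_div h, Real.inv_rpow hh.le,
      Complex.ofReal_inv, one_div, inv_inv]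
  have hs : 𝓕 (wavePacket h p) ω = c * 𝓕 (fun x : ℝ =>
      Complex.exp (-Real.pi * (1 / h : ℂ) * x ^ 2 +
        2 * Real.pi * (Complex.I * p.2 / h + p.1 / h) * x)) ω := by
    rw [e, Real.fourier_eq, Real.fourier_eq, ← smul_eq_mul c, ← integral_smul]
    refine integral_congr_ae (Eventually.of_forall fun x => ?_)
    exact smul_comm _ _ _
  rw [hs, fourier_gaussian_pi' hb, hroot, hc]
  push_cast
  rw [mul_mul_mul_comm, ← Complex.exp_add]
  congr 2
  field_simp
  ring_nf
  simp only [Complex.I_sq, Complex.I_pow_three, Complex.I_pow_four]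
  ring

theorem integrable_wavePacket {h : ℝ} (hh : 0 < h) (p : ℝ × ℝ) : Integrable (wavePacket h p) := by
  have hb : 0 < (Real.pi / h : ℂ).re := by
    rw [← Complex.ofReal_div, Complex.ofReal_re]; positivity
  have hi := (integrable_cexp_quadratic hb (2 * Real.pi * (Complex.I * p.2 / h + p.1 / h))
    (-2 * Real.pi * Complex.I * p.1 * p.2 / h - Real.pi * p.1 ^ 2 / h)).const_mul
    ((((2 / h) ^ (1 / 4 : ℝ) : ℝ) : ℂ))
  refine hi.congr (Eventually.of_forall fun t => ?_)
  simp only [wavePacket]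
  have hh' : (h : ℂ) ≠ 0 := by exact_mod_cast hh.ne'
  rw [mul_assoc (Complex.ofReal _), ← Complex.exp_add]
  congr 2
  field_simp
  ring

theorem setIntegral_exp_mul_eq_fourierInv {A : Set ℝ} (hA : MeasurableSet A) (g : ℝ → ℂ) (t : ℝ) :
    ∫ ω in A, Complex.exp (2 * Real.pi * Complex.I * t * ω) * g ω = 𝓕⁻ (A.indicator g) t := by
  rw [Real.fourierInv_eq', ← integral_indicator hA]
  refine integral_congr_ae (Eventually.of_forall fun ω => ?_)
  by_cases h : ω ∈ A
  · simp only [h, indicator_of_mem, smul_eq_mul, RCLike.inner_apply, conj_trivial]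
    push_cast
    ring_nf
  · simp [h]

/-- A superposition of plane waves over `A` with an integrable bounded density lies in `L²`. -/
theorem memLp_two_setIntegral_exp_mul {A : Set ℝ} (hA : MeasurableSet A) {g : ℝ → ℂ}
    (hg : IntegrableOn g A) {C : ℝ} (hC : ∀ ω ∈ A, ‖g ω‖ ≤ C) :
    MemLp (fun t : ℝ => ∫ ω in A, Complex.exp (2 * Real.pi * Complex.I * t * ω) * g ω) 2 := by
  simp only [setIntegral_exp_mul_eq_fourierInv hA]
  have h1 : Integrable (A.indicator g) := (integrable_indicator_iff hA).mpr hg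
  refine memLp_two_fourierInv h1 ?_
  refine (memLp_two_iff_integrable_sq_norm h1.aestronglyMeasurable).mpr ?_
  simp only [sq]
  refine h1.norm.bdd_mul (c := |C|) h1.norm.aestronglyMeasurable (Eventually.of_forall fun ω => ?_)
  by_cases h : ω ∈ A
  · simpa [h] using (hC ω h).trans (le_abs_self C)
  · simp [h]

/-- Parseval's formula for pairings with a wave packet. -/
theorem integral_setIntegral_exp_mul_conj_wavePacket {A : Set ℝ} (hA : MeasurableSet A)
    {g : ℝ → ℂ} (hg : IntegrableOn g A) {h : ℝ} (hh : 0 < h) (p : ℝ × ℝ) :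
    ∫ t : ℝ, (∫ ω in A, Complex.exp (2 * Real.pi * Complex.I * t * ω) * g ω) *
      conj (wavePacket h p t) = ∫ ω in A, g ω * conj (𝓕 (wavePacket h p) ω) := by
  simp only [setIntegral_exp_mul_eq_fourierInv hA]
  have hc : Integrable (fun t => conj (wavePacket h p t)) :=
    (LinearIsometryEquiv.integrable_comp_iff Complex.conjLIE).mpr (integrable_wavePacket hh p)
  rw [integral_fourierInv_mul ((integrable_indicator_iff hA).mpr hg) hc, ← integral_indicator hA]
  refine integral_congr_ae (Eventually.of_forall fun ω => ?_)
  have e : 𝓕⁻ (fun t => conj (wavePacket h p t)) ω = conj (𝓕 (wavePacket h p) ω) := by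
    rw [Real.fourierInv_eq', Real.fourier_eq', ← integral_conj]
    refine integral_congr_ae (Eventually.of_forall fun t => ?_)
    simp only [smul_eq_mul, map_mul, ← Complex.exp_conj, Complex.conj_I, Complex.conj_ofReal]
    push_cast
    ring_nf
  by_cases h : ω ∈ A <;> simp [h, e]

/-! ### Exponential smallness by deformation of the contour -/

theorem norm_exp_div_le {w : ℂ} {ε h : ℝ} (hh : 0 < h) (hw : w.re ≤ -ε) :
    ‖Complex.exp (w / h)‖ ≤ Real.exp (-ε / h) := by
  rw [Complex.norm_exp, Complex.div_ofReal_re]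
  gcongr

/-- By Cauchy's theorem the integral of an entire function over `[a, b]` is controlled by its size on
the other three sides of the rectangle with corners `a` and `b + τ i`; the height `τ` may have
either sign. -/
theorem norm_setIntegral_le_of_rect {f : ℂ → ℂ} (hf : Differentiable ℂ f) {a b τ m : ℝ}
    (hab : a ≤ b)
    (hleft : ∀ t ∈ uIcc 0 τ, ‖f (a + t * Complex.I)‖ ≤ m)
    (hright : ∀ t ∈ uIcc 0 τ, ‖f (b + t * Complex.I)‖ ≤ m)
    (htop : ∀ η ∈ Icc a b, ‖f (η + τ * Complex.I)‖ ≤ m) :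
    ‖∫ η in Icc a b, f η‖ ≤ m * ((b - a) + 2 * |τ|) := by
  have h := Complex.integral_boundary_rect_eq_zero_of_differentiableOn f (a : ℂ)
    (b + τ * Complex.I) hf.differentiableOn
  simp only [Complex.ofReal_re, Complex.ofReal_im, Complex.add_re, Complex.mul_re, Complex.I_re,
    Complex.I_im, Complex.add_im, Complex.mul_im, mul_zero, mul_one, zero_mul, sub_zero, add_zero,
    zero_add, Complex.ofReal_zero, smul_eq_mul] at h
  rw [integral_Icc_eq_integral_Ioc, ← intervalIntegral.integral_of_le hab]
  have e : ∫ x in a..b, f x = (∫ x in a..b, f (x + τ * Complex.I)) -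
      Complex.I * (∫ y in (0 : ℝ)..τ, f (b + y * Complex.I)) +
      Complex.I * ∫ y in (0 : ℝ)..τ, f (a + y * Complex.I) := by linear_combination h
  rw [e]
  have h1 : ‖∫ x in a..b, f (x + τ * Complex.I)‖ ≤ m * |b - a| :=
    intervalIntegral.norm_integral_le_of_norm_le_const fun x hx =>
      htop x (by rw [uIoc_of_le hab] at hx; exact Ioc_subset_Icc_self hx)
  have h2 : ‖∫ y in (0 : ℝ)..τ, f (b + y * Complex.I)‖ ≤ m * |τ - 0| :=
    intervalIntegral.norm_integral_le_of_norm_le_const fun x hx =>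
      hright x (uIoc_subset_uIcc hx)
  have h3 : ‖∫ y in (0 : ℝ)..τ, f (a + y * Complex.I)‖ ≤ m * |τ - 0| :=
    intervalIntegral.norm_integral_le_of_norm_le_const fun x hx =>
      hleft x (uIoc_subset_uIcc hx)
  rw [abs_of_nonneg (sub_nonneg.mpr hab)] at h1
  rw [sub_zero] at h2 h3
  refine (norm_add_le _ _).trans ((add_le_add_left (norm_sub_le _ _) _).trans ?_)
  rw [norm_mul, norm_mul, Complex.norm_I, one_mul, one_mul]
  linarith

/-- If `Re (Φ p₁)` is negative on the part of `closure Ω` outside `(a, b)` and on the three sides that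
replace `[a, b]`, then the oscillatory integral over `Ω` is exponentially small, uniformly for `p`
near `p₁`. These sets form a compact contour, so that negativity at `p₁` persists, with a uniform
margin, for nearby `p`. -/
theorem exists_eventually_norm_setIntegral_le {Φ : ℝ × ℝ → ℂ → ℂ}
    (hΦ : Continuous fun x : (ℝ × ℝ) × ℂ => Φ x.1 x.2) (hΦd : ∀ p, Differentiable ℂ (Φ p))
    {Ω : Set ℝ} (hb : Bornology.IsBounded Ω) {a b τ : ℝ} (hab : a ≤ b)
    (habΩ : Icc a b ⊆ Ω) {A : ℝ → ℝ} (hA : Continuous A) {B : ℂ → ℂ} (hB : Differentiable ℂ B)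
    (hAB : ∀ η ∈ Icc a b, (A η : ℂ) = B η) (p₁ : ℝ × ℝ)
    (hout : ∀ η ∈ closure Ω \ Ioo a b, (Φ p₁ (η : ℝ)).re < 0)
    (hleft : ∀ t ∈ uIcc 0 τ, (Φ p₁ (a + t * Complex.I)).re < 0)
    (hright : ∀ t ∈ uIcc 0 τ, (Φ p₁ (b + t * Complex.I)).re < 0)
    (htop : ∀ η ∈ Icc a b, (Φ p₁ (η + τ * Complex.I)).re < 0) :
    ∃ C ε : ℝ, 0 < ε ∧ ∀ᶠ p in 𝓝 p₁, ∀ h : ℝ, 0 < h →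
      ‖∫ η in Ω, (A η : ℂ) * Complex.exp (Φ p η / h)‖ ≤ C * Real.exp (-ε / h) := by
  have hcl : IsCompact (closure Ω) := hb.isCompact_closure
  set K : Set ℂ := (fun η : ℝ => (η : ℂ)) '' (closure Ω \ Ioo a b) ∪
    ((fun t : ℝ => (a + t * Complex.I : ℂ)) '' uIcc 0 τ ∪
    ((fun t : ℝ => (b + t * Complex.I : ℂ)) '' uIcc 0 τ ∪
    (fun η : ℝ => (η + τ * Complex.I : ℂ)) '' Icc a b)) with hK
  have hKc : IsCompact K := by
    refine ((hcl.diff isOpen_Ioo).image (by fun_prop)).union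
      ((isCompact_uIcc.image (by fun_prop)).union
      ((isCompact_uIcc.image (by fun_prop)).union (isCompact_Icc.image (by fun_prop))))
  have hKneg : ∀ z ∈ K, (Φ p₁ z).re < 0 := by
    rintro z (⟨η, hη, rfl⟩ | ⟨t, ht, rfl⟩ | ⟨t, ht, rfl⟩ | ⟨η, hη, rfl⟩)
    exacts [hout η hη, hleft t ht, hright t ht, htop η hη]
  have hKne : K.Nonempty := ⟨_, Or.inr (Or.inl ⟨0, left_mem_uIcc, rfl⟩)⟩
  have hcre : Continuous fun x : (ℝ × ℝ) × ℂ => (Φ x.1 x.2).re := Complex.continuous_re.comp hΦ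
  -- `z₀` is the worst point of the contour
  obtain ⟨z₀, hz₀, hmax⟩ := hKc.exists_isMaxOn hKne
    (f := fun z => (Φ p₁ z).re)
    (hcre.comp (by fun_prop : Continuous fun z : ℂ => (p₁, z))).continuousOn
  -- half of the margin at `p₁`, to leave room for nearby `p`
  set ε : ℝ := -(Φ p₁ z₀).re / 2 with hε
  have hz0 := hKneg z₀ hz₀
  have hεpos : 0 < ε := by rw [hε]; linarith
  have hev : ∀ᶠ p in 𝓝 p₁, ∀ z ∈ K, (Φ p z).re < -ε := by
    refine hKc.eventually_forall_of_forall_eventually fun z hz => ?_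
    refine hcre.continuousAt.eventually_lt continuousAt_const ?_
    have := hmax hz
    simp only [mem_ofPred_eq] at this
    show (Φ p₁ z).re < -ε
    rw [hε]; linarith
  obtain ⟨MA, hMA⟩ := hcl.exists_bound_of_continuousOn hA.continuousOn
  obtain ⟨MB, hMB⟩ := hKc.exists_bound_of_continuousOn hB.continuous.continuousOn
  refine ⟨MB * ((b - a) + 2 * |τ|) + MA * volume.real (Ω \ Icc a b), ε, hεpos, ?_⟩
  filter_upwards [hev] with p hp h hh
  have hc : Continuous fun η : ℝ => (A η : ℂ) * Complex.exp (Φ p η / h) := by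
    have := (hΦd p).continuous
    fun_prop
  have hint : IntegrableOn (fun η : ℝ => (A η : ℂ) * Complex.exp (Φ p η / h)) Ω :=
    (hc.continuousOn.integrableOn_compact hcl).mono_set subset_closure
  have hsplit := setIntegral_sdiff measurableSet_Icc hint habΩ
  have hin : ‖∫ η in Icc a b, (A η : ℂ) * Complex.exp (Φ p η / h)‖ ≤
      MB * Real.exp (-ε / h) * ((b - a) + 2 * |τ|) := by
    rw [setIntegral_congr_fun measurableSet_Icc
      (g := fun η : ℝ => (fun z : ℂ => B z * Complex.exp (Φ p z / h)) η)
      (fun η hη => by simp only [hAB η hη])]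
    have hbd : ∀ z ∈ K, ‖B z * Complex.exp (Φ p z / h)‖ ≤ MB * Real.exp (-ε / h) := fun z hz => by
      rw [norm_mul]
      exact mul_le_mul (hMB z hz) (norm_exp_div_le hh (hp z hz).le) (norm_nonneg _)
        ((norm_nonneg _).trans (hMB z hz))
    refine norm_setIntegral_le_of_rect (f := fun z : ℂ => B z * Complex.exp (Φ p z / h))
      (hB.mul ((hΦd p).div_const _).cexp) hab ?_ ?_ ?_
    · exact fun t ht => hbd _ (Or.inr (Or.inl ⟨t, ht, rfl⟩))
    · exact fun t ht => hbd _ (Or.inr (Or.inr (Or.inl ⟨t, ht, rfl⟩)))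
    · exact fun t ht => hbd _ (Or.inr (Or.inr (Or.inr ⟨t, ht, rfl⟩)))
  have hfin : volume (Ω \ Icc a b) < ⊤ := (measure_mono sdiff_subset).trans_lt hb.measure_lt_top
  have hou : ‖∫ η in Ω \ Icc a b, (A η : ℂ) * Complex.exp (Φ p η / h)‖ ≤
      MA * Real.exp (-ε / h) * volume.real (Ω \ Icc a b) := by
    refine norm_setIntegral_le_of_norm_le_const hfin fun η hη => ?_
    have hη' : η ∈ closure Ω \ Ioo a b :=
      ⟨subset_closure hη.1, fun h => hη.2 (Ioo_subset_Icc_self h)⟩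
    rw [norm_mul, Complex.norm_real]
    exact mul_le_mul (hMA η hη'.1) (norm_exp_div_le hh (hp _ (Or.inl ⟨η, hη', rfl⟩)).le)
      (norm_nonneg _) ((norm_nonneg _).trans (hMA η hη'.1))
  calc _ = ‖(∫ η in Icc a b, (A η : ℂ) * Complex.exp (Φ p η / h)) +
        ∫ η in Ω \ Icc a b, (A η : ℂ) * Complex.exp (Φ p η / h)‖ := by rw [hsplit, add_sub_cancel]
    _ ≤ _ := norm_add_le _ _
    _ ≤ _ := add_le_add hin hou
    _ = _ := by ring

/-- If the imaginary part of the derivative of `f` does not vanish at a real point, then moving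
vertically to the appropriate side decreases the real part of `f` near that point. -/
theorem exists_re_add_mul_I_lt {f : ℂ → ℂ} (hf : Differentiable ℂ f) {η₀ : ℝ}
    (hd : (deriv f η₀).im ≠ 0) :
    ∃ ρ > 0, ∃ σ : ℝ, ∀ η : ℝ, |η - η₀| < ρ → ∀ t : ℝ, 0 < t → t < ρ →
      (f (η + (σ * t : ℝ) * Complex.I)).re < (f η).re := by
  -- `σ` is the sign of `Im f'(η₀)`; moving up by `t` changes `Re f` by about `-t Im f'`
  obtain ⟨σ, hσ, hσd⟩ : ∃ σ : ℝ, |σ| = 1 ∧ 0 < σ * (deriv f η₀).im := by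
    rcases hd.lt_or_gt with h | h
    · exact ⟨-1, by simp, by linarith⟩
    · exact ⟨1, by simp, by linarith⟩
  have hcd : Continuous (deriv f) := (hf.contDiff (n := 1)).continuous_deriv le_rfl
  have hev : ∀ᶠ z in 𝓝 (η₀ : ℂ), 0 < σ * (deriv f z).im :=
    continuousAt_const.eventually_lt
      (continuous_const.mul (Complex.continuous_im.comp hcd)).continuousAt hσd
  obtain ⟨r, hr, hball⟩ := Metric.eventually_nhds_iff.mp hev
  refine ⟨r / 2, by positivity, σ, fun η hη t ht htr => ?_⟩
  have hder : ∀ y : ℝ, HasDerivAt (fun y : ℝ => (f (η + (σ * y : ℝ) * Complex.I)).re)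
      (-(σ * (deriv f (η + (σ * y : ℝ) * Complex.I)).im)) y := fun y => by
    have h1 : HasDerivAt (fun y : ℝ => (η + (σ * y : ℝ) * Complex.I : ℂ)) (σ * Complex.I) y := by
      have := ((((hasDerivAt_id y).const_mul σ).ofReal_comp).mul_const Complex.I).const_add (η : ℂ)
      simpa using this
    have h2 := (hf (η + (σ * y : ℝ) * Complex.I)).hasDerivAt.comp y h1
    have h3 := Complex.reCLM.hasFDerivAt.comp_hasDerivAt y h2
    convert! h3 using 1
    simp [mul_comm]
  have hanti : StrictAntiOn (fun y : ℝ => (f (η + (σ * y : ℝ) * Complex.I)).re) (Icc 0 t) := by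
    refine strictAntiOn_of_deriv_neg (convex_Icc _ _)
      (fun y _ => (hder y).continuousAt.continuousWithinAt) fun y hy => ?_
    rw [interior_Icc] at hy
    rw [(hder y).deriv, neg_lt_zero]
    apply hball
    rw [Complex.dist_eq]
    have : (η + (σ * y : ℝ) * Complex.I - η₀ : ℂ) = ((η - η₀ : ℝ) : ℂ) + (σ * y : ℝ) * Complex.I := by
      push_cast; ring
    rw [this]
    refine (norm_add_le _ _).trans_lt ?_
    rw [norm_mul, Complex.norm_I, Complex.norm_real, Complex.norm_real, Real.norm_eq_abs,
      Real.norm_eq_abs, abs_mul, hσ, abs_of_pos hy.1]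
    linarith [hy.2]
  simpa using hanti ⟨le_rfl, ht.le⟩ ⟨ht.le, le_rfl⟩ ht

/-- Exponential smallness when `Re (Φ p₁) ≤ 0` on the real line with equality on `closure Ω` at most at
`η₀`, and `η₀` is not a real critical point: the contour is pushed off the real axis near `η₀`, to
the side on which `Re (Φ p₁)` decreases. -/
theorem exists_eventually_norm_setIntegral_le_of_not_critical {Φ : ℝ × ℝ → ℂ → ℂ}
    (hΦ : Continuous fun x : (ℝ × ℝ) × ℂ => Φ x.1 x.2) (hΦd : ∀ p, Differentiable ℂ (Φ p))
    {Ω : Set ℝ} (hb : Bornology.IsBounded Ω) {η₀ : ℝ} (hη₀ : η₀ ∈ interior Ω)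
    {A : ℝ → ℝ} (hA : Continuous A) {B : ℂ → ℂ} (hB : Differentiable ℂ B)
    (hAB : ∀ᶠ η in 𝓝 η₀, (A η : ℂ) = B (η : ℝ)) (p₁ : ℝ × ℝ)
    (hle : ∀ η : ℝ, (Φ p₁ η).re ≤ 0)
    (hlt : ∀ η ∈ closure Ω, η ≠ η₀ → (Φ p₁ (η : ℝ)).re < 0)
    (hcrit : (Φ p₁ η₀).re < 0 ∨ (deriv (Φ p₁) η₀).im ≠ 0) :
    ∃ C ε : ℝ, 0 < ε ∧ ∀ᶠ p in 𝓝 p₁, ∀ h : ℝ, 0 < h →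
      ‖∫ η in Ω, (A η : ℂ) * Complex.exp (Φ p η / h)‖ ≤ C * Real.exp (-ε / h) := by
  obtain ⟨r, hr, hball⟩ := Metric.eventually_nhds_iff.mp
    (hAB.and (mem_interior_iff_mem_nhds.mp hη₀))
  rcases hcrit with h0 | h0
  · have hneg : ∀ η ∈ closure Ω, (Φ p₁ (η : ℝ)).re < 0 := fun η hη => by
      by_cases h : η = η₀
      · rwa [h]
      · exact hlt η hη h
    have h0' : (A η₀ : ℂ) = B (η₀ : ℝ) ∧ η₀ ∈ Ω := hball (y := η₀) (by simpa using hr)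
    -- a degenerate rectangle: no deformation is needed
    refine exists_eventually_norm_setIntegral_le hΦ hΦd hb (a := η₀) (b := η₀) (τ := 0) le_rfl
      ?_ hA hB ?_ p₁ (fun η hη => hneg η hη.1) ?_ ?_ ?_
    · simpa using h0'.2
    · simpa using h0'.1
    all_goals simpa using h0
  · obtain ⟨ρ, hρ, σ, hσ⟩ := exists_re_add_mul_I_lt (hΦd p₁) h0
    obtain ⟨δ, hδ, hδr⟩ : ∃ δ > 0, δ < min r ρ := exists_between (lt_min hr hρ)
    have hδ1 : δ < r := hδr.trans_le (min_le_left _ _)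
    have hδ2 : δ < ρ := hδr.trans_le (min_le_right _ _)
    have hIcc : ∀ η ∈ Icc (η₀ - δ) (η₀ + δ), |η - η₀| ≤ δ := fun η hη => by
      rw [abs_le]; constructor <;> linarith [hη.1, hη.2]
    have hsub : ∀ η ∈ Icc (η₀ - δ) (η₀ + δ), (A η : ℂ) = B (η : ℝ) ∧ η ∈ Ω := fun η hη =>
      hball (by rw [Real.dist_eq]; exact (hIcc η hη).trans_lt hδ1)
    have hside : ∀ η ∈ Icc (η₀ - δ) (η₀ + δ), η ≠ η₀ → ∀ t ∈ uIcc 0 (σ * δ),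
        (Φ p₁ (η + t * Complex.I)).re < 0 := fun η hη hne t ht => by
      have hneg := hlt η (subset_closure (hsub η hη).2) hne
      obtain ⟨s, hs, rfl⟩ : ∃ s ∈ Icc 0 δ, σ * s = t := by
        have h1 : (fun s => σ * s) '' uIcc 0 δ = uIcc (σ * 0) (σ * δ) := image_const_mul_uIcc _ _ _
        rw [mul_zero, uIcc_of_le hδ.le] at h1
        rw [← h1] at ht
        exact ht
      rcases hs.1.eq_or_lt with h | h
      · simpa [← h] using hneg
      · exact (hσ η ((hIcc η hη).trans_lt hδ2) s h (hs.2.trans_lt hδ2)).trans hneg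
    refine exists_eventually_norm_setIntegral_le hΦ hΦd hb (a := η₀ - δ) (b := η₀ + δ)
      (τ := σ * δ) (by linarith) (fun η hη => (hsub η hη).2) hA hB (fun η hη => (hsub η hη).1) p₁
      (fun η hη => hlt η hη.1 ?_) ?_ ?_ ?_
    · rintro rfl
      exact hη.2 ⟨by linarith, by linarith⟩
    · exact hside _ ⟨le_rfl, by linarith⟩ (by linarith)
    · exact hside _ ⟨by linarith, le_rfl⟩ (by linarith)
    · exact fun η hη => (hσ η ((hIcc η hη).trans_lt hδ2) δ hδ hδ2).trans_le (hle η)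

/-! ### From exponential bounds to microlocal smallness -/

theorem exp_neg_div_le {ε h : ℝ} (hε : 0 < ε) (hh : 0 < h) (n : ℕ) :
    Real.exp (-ε / h) ≤ n.factorial / ε ^ n * h ^ n := by
  have h1 := Real.pow_div_factorial_le_exp (ε / h) (by positivity) n
  have h2 : 0 < (ε / h) ^ n / n.factorial := by positivity
  rw [neg_div, Real.exp_neg]
  refine (inv_anti₀ h2 h1).trans (le_of_eq ?_)
  rw [div_pow]
  field_simp

theorem rpow_quarter_sq {x : ℝ} (hx : 0 ≤ x) : (x ^ (1 / 4 : ℝ)) ^ 2 = √x := by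
  rw [← Real.rpow_natCast, ← Real.rpow_mul hx, Real.sqrt_eq_rpow]
  norm_num

theorem microlocallySmall_of_exp_bound {u : ℝ → ℝ → ℂ} {p₁ : ℝ × ℝ} {C ε : ℝ} (hε : 0 < ε)
    (hu : ∀ᶠ p in 𝓝 p₁, ∀ h : ℝ, 0 < h →
      ‖∫ t : ℝ, u h t * conj (wavePacket h p t)‖ ≤ √(2 / h) * (C * Real.exp (-ε / h))) :
    MicrolocallySmall u p₁ := by
  -- order `N + 1` pays for the factor `√(2 / h) ≤ 2 / h`
  refine ⟨_, hu, fun N => ⟨2 * (|C| * ((N + 1).factorial / ε ^ (N + 1))), ?_⟩⟩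
  filter_upwards [Ioo_mem_nhdsGT (zero_lt_one' ℝ)] with h hh p hp
  have hh0 : 0 < h := hh.1
  refine (hp h hh0).trans ?_
  have h1 : √(2 / h) ≤ 2 / h := by
    rw [Real.sqrt_le_left (by positivity)]
    have : 1 ≤ 2 / h := by rw [le_div_iff₀ hh0]; linarith [hh.2]
    nlinarith
  have h2 := exp_neg_div_le hε hh0 (N + 1)
  calc √(2 / h) * (C * Real.exp (-ε / h))
      ≤ 2 / h * (|C| * ((N + 1).factorial / ε ^ (N + 1) * h ^ (N + 1))) := by
        have h3 : C * Real.exp (-ε / h) ≤ |C| * ((N + 1).factorial / ε ^ (N + 1) * h ^ (N + 1)) :=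
          (mul_le_mul_of_nonneg_right (le_abs_self C) (Real.exp_pos _).le).trans
            (mul_le_mul_of_nonneg_left h2 (abs_nonneg _))
        exact (mul_le_mul_of_nonneg_left h3 (Real.sqrt_nonneg _)).trans
          (mul_le_mul_of_nonneg_right h1 (by positivity))
    _ = _ := by
        field_simp
        ring

/-! ### The Laplace asymptotics at the critical point -/

/-- Second order Taylor expansion of an entire function at a critical point, with continuous
remainder factor. -/
theorem exists_continuous_sq_mul {f : ℂ → ℂ} (hf : Differentiable ℂ f) {z₀ : ℂ}
    (hd : deriv f z₀ = 0) : ∃ g : ℂ → ℂ, Continuous g ∧ ∀ z, f z - f z₀ = (z - z₀) ^ 2 * g z := by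
  have h1 : Differentiable ℂ (dslope f z₀) := by
    rw [← differentiableOn_univ, Complex.differentiableOn_dslope univ_mem]
    exact hf.differentiableOn
  have h2 : Differentiable ℂ (dslope (dslope f z₀) z₀) := by
    rw [← differentiableOn_univ, Complex.differentiableOn_dslope univ_mem]
    exact h1.differentiableOn
  refine ⟨_, h2.continuous, fun z => ?_⟩
  have e1 := sub_smul_dslope f z₀ z
  have e2 := sub_smul_dslope (dslope f z₀) z₀ z
  rw [dslope_same, hd, sub_zero] at e2
  rw [← e1, ← e2, smul_eq_mul, smul_eq_mul]
  ring

/-- Laplace's method at the scale `η = η₀ + k s`, `k = √h`, in the situation where `Re Ψ` is bounded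
above by a Gaussian on the whole real line: the rescaled integrals converge to a nonzero complex
Gaussian integral. -/
theorem tendsto_laplace_integral {Ψ : ℂ → ℂ} (hΨ : Differentiable ℂ Ψ) {η₀ : ℝ}
    (hd : deriv Ψ η₀ = 0) (hre : ∀ η : ℝ, (Ψ η - Ψ η₀).re ≤ -Real.pi * (η - η₀) ^ 2)
    {Ω : Set ℝ} (hb : Bornology.IsBounded Ω) (hm : MeasurableSet Ω) (hη₀ : η₀ ∈ interior Ω)
    {A : ℝ → ℝ} (hA : Continuous A) (hA0 : A η₀ ≠ 0) :
    ∃ L : ℂ, L ≠ 0 ∧ Tendsto (fun k : ℝ =>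
      (k⁻¹ : ℂ) * ∫ η in Ω, (A η : ℂ) * Complex.exp ((Ψ η - Ψ η₀) / (k ^ 2 : ℝ)))
      (𝓝[>] 0) (𝓝 L) := by
  obtain ⟨g, hg, hgΨ⟩ := exists_continuous_sq_mul hΨ hd
  -- the Hessian inherits the quadratic bound on the real axis
  have hgre : (g η₀).re ≤ -Real.pi := by
    have hcont : Continuous fun η : ℝ => (g η).re :=
      Complex.continuous_re.comp (hg.comp Complex.continuous_ofReal)
    have hclosed : IsClosed {η : ℝ | (g η).re ≤ -Real.pi} := isClosed_le hcont continuous_const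
    have hsub : ({η₀}ᶜ : Set ℝ) ⊆ {η : ℝ | (g η).re ≤ -Real.pi} := fun η hη => by
      have h := hre η
      have e : ((η : ℂ) - η₀) ^ 2 = (((η - η₀) ^ 2 : ℝ) : ℂ) := by push_cast; ring
      rw [hgΨ, e, Complex.re_ofReal_mul] at h
      have hpos : 0 < (η - η₀) ^ 2 := by
        have : η - η₀ ≠ 0 := sub_ne_zero.mpr hη
        positivity
      show (g η).re ≤ -Real.pi
      nlinarith
    have := closure_minimal hsub hclosed
    rw [(dense_compl_singleton η₀).closure_eq] at this
    exact this (mem_univ η₀)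
  have hbre : 0 < (-g η₀).re := by
    rw [Complex.neg_re]; linarith [Real.pi_pos]
  have hg0 : -g η₀ ≠ 0 := fun h => by simp [h] at hbre
  refine ⟨(A η₀ : ℂ) * (Real.pi / -g η₀) ^ (1 / 2 : ℂ), ?_, ?_⟩
  · refine mul_ne_zero (by exact_mod_cast hA0) ?_
    rw [Complex.cpow_ne_zero_iff]
    exact Or.inl (div_ne_zero (by exact_mod_cast Real.pi_ne_zero) hg0)
  obtain ⟨M, hM⟩ := hb.isCompact_closure.exists_bound_of_continuousOn hA.continuousOn
  have hM0 : 0 ≤ M := (norm_nonneg _).trans (hM η₀ (subset_closure (interior_subset hη₀)))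
  set F : ℝ → ℝ → ℂ := fun k s => Ω.indicator (fun η : ℝ => (A η : ℂ) *
    Complex.exp ((Ψ η - Ψ η₀) / (k ^ 2 : ℝ))) (η₀ + k * s) with hF
  have hscale : ∀ k : ℝ, 0 < k →
      (k⁻¹ : ℂ) * ∫ η in Ω, (A η : ℂ) * Complex.exp ((Ψ η - Ψ η₀) / (k ^ 2 : ℝ)) = ∫ s, F k s := by
    intro k hk
    rw [← integral_indicator hm]
    simp only [hF]
    set f := Ω.indicator (fun η : ℝ => (A η : ℂ) *
      Complex.exp ((Ψ η - Ψ η₀) / (k ^ 2 : ℝ)))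
    rw [Measure.integral_comp_mul_left (fun y => f (η₀ + y)) k, integral_add_left_eq_self,
      abs_of_pos (inv_pos.mpr hk), Complex.real_smul, Complex.ofReal_inv]
  have hlim : ∫ s : ℝ, (A η₀ : ℂ) * Complex.exp (-(-g η₀) * (s : ℂ) ^ 2) =
      (A η₀ : ℂ) * (Real.pi / -g η₀) ^ (1 / 2 : ℂ) := by
    rw [integral_const_mul, integral_gaussian_complex hbre]
  rw [← hlim]
  have hdom : Tendsto (fun k : ℝ => ∫ s, F k s) (𝓝[>] 0)
      (𝓝 (∫ s : ℝ, (A η₀ : ℂ) * Complex.exp (-(-g η₀) * (s : ℂ) ^ 2))) := by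
    refine tendsto_integral_filter_of_dominated_convergence
      (fun s => M * Real.exp (-Real.pi * s ^ 2)) ?_ ?_ ?_ ?_
    · refine Eventually.of_forall fun k => ?_
      have hc : Continuous fun η : ℝ => (A η : ℂ) * Complex.exp ((Ψ η - Ψ η₀) / (k ^ 2 : ℝ)) := by
        have := hΨ.continuous
        fun_prop
      exact ((hc.measurable.indicator hm).comp (by fun_prop : Measurable fun s : ℝ =>
        η₀ + k * s)).aestronglyMeasurable
    · filter_upwards [self_mem_nhdsWithin] with k hk
      have hk0 : 0 < k := hk
      refine Eventually.of_forall fun s => ?_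
      by_cases h : η₀ + k * s ∈ Ω
      · simp only [hF, indicator_of_mem h, norm_mul, Complex.norm_real]
        refine mul_le_mul (hM _ (subset_closure h)) ?_ (norm_nonneg _) hM0
        rw [Complex.norm_exp, Complex.div_ofReal_re, Real.exp_le_exp, div_le_iff₀ (by positivity)]
        refine (hre _).trans (le_of_eq ?_)
        ring
      · simp only [hF, indicator_of_notMem h, norm_zero]
        positivity
    · exact (integrable_exp_neg_mul_sq Real.pi_pos).const_mul M
    · refine Eventually.of_forall fun s => ?_
      have hts : Tendsto (fun k : ℝ => η₀ + k * s) (𝓝[>] 0) (𝓝 η₀) := by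
        have : Continuous fun k : ℝ => η₀ + k * s := by fun_prop
        have := (this.tendsto 0).mono_left (nhdsWithin_le_nhds (s := Ioi 0))
        simpa using this
      have hev : ∀ᶠ k : ℝ in 𝓝[>] 0, F k s = (A (η₀ + k * s) : ℂ) *
          Complex.exp ((s : ℂ) ^ 2 * g ((η₀ + k * s : ℝ) : ℂ)) := by
        filter_upwards [hts.eventually (mem_interior_iff_mem_nhds.mp hη₀), self_mem_nhdsWithin]
          with k hk hk0
        have hk0 : (k : ℂ) ≠ 0 := by exact_mod_cast (ne_of_gt hk0)
        simp only [hF, indicator_of_mem hk]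
        congr 2
        rw [hgΨ]
        push_cast
        field_simp
        ring
      refine Tendsto.congr' (EventuallyEq.symm hev) ?_
      have hct : Continuous fun η : ℝ => (A η : ℂ) * Complex.exp ((s : ℂ) ^ 2 * g (η : ℂ)) := by
        fun_prop
      have := (hct.tendsto η₀).comp hts
      convert! this using 2
      ring_nf
  refine hdom.congr' ?_
  filter_upwards [self_mem_nhdsWithin] with k hk
  exact (hscale k hk).symm

/-! ### The wavefront set of an oscillatory superposition -/

/-- The phase function of the pairing of the superposition `∫ exp (2πi t r(η) / h) φ^(s(η) / h) dη`
of plane waves, where `φ` is the wave packet at `p₀`, with the wave packet at `p`. Here `R` and `S`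
are entire extensions of `r` and `s`. -/
noncomputable def packetPhase (R S : ℂ → ℂ) (p₀ p : ℝ × ℝ) (z : ℂ) : ℂ :=
  2 * Real.pi * Complex.I * (p.1 * R z - p₀.1 * S z) -
    Real.pi * ((S z - p₀.2) ^ 2 + (R z - p.2) ^ 2)

section packetPhase

variable {R S : ℂ → ℂ} {r s : ℝ → ℝ} (p₀ p : ℝ × ℝ)

theorem differentiable_packetPhase (hR : Differentiable ℂ R) (hS : Differentiable ℂ S) :
    Differentiable ℂ (packetPhase R S p₀ p) := by
  unfold packetPhase
  fun_prop

theorem continuous_packetPhase (hR : Continuous R) (hS : Continuous S) :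
    Continuous fun x : (ℝ × ℝ) × ℂ => packetPhase R S p₀ x.1 x.2 := by
  unfold packetPhase
  fun_prop

theorem packetPhase_ofReal (hr : ∀ η : ℝ, R η = r η) (hs : ∀ η : ℝ, S η = s η) (η : ℝ) :
    packetPhase R S p₀ p η = ((2 * Real.pi * (p.1 * r η - p₀.1 * s η) : ℝ) : ℂ) * Complex.I +
      ((-Real.pi * ((s η - p₀.2) ^ 2 + (r η - p.2) ^ 2) : ℝ) : ℂ) := by
  rw [packetPhase, hr, hs]
  push_cast
  ring

/-- On the real line the real part of the phase is nonpositive, since the oscillatory term is purely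
imaginary. -/
theorem packetPhase_ofReal_re (hr : ∀ η : ℝ, R η = r η) (hs : ∀ η : ℝ, S η = s η) (η : ℝ) :
    (packetPhase R S p₀ p η).re = -Real.pi * ((s η - p₀.2) ^ 2 + (r η - p.2) ^ 2) := by
  rw [packetPhase_ofReal p₀ p hr hs, Complex.add_re, Complex.re_ofReal_mul, Complex.I_re, mul_zero,
    zero_add, Complex.ofReal_re]

/-- At a point where the Gaussian part of the phase vanishes, it does not contribute to the
derivative either. -/
theorem deriv_packetPhase {z r' s' : ℂ} (hR : HasDerivAt R r' z) (hS : HasDerivAt S s' z)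
    (hS0 : S z = p₀.2) (hR0 : R z = p.2) :
    deriv (packetPhase R S p₀ p) z = 2 * Real.pi * Complex.I * (p.1 * r' - p₀.1 * s') := by
  have h := (((hR.const_mul (p.1 : ℂ)).sub (hS.const_mul (p₀.1 : ℂ))).const_mul
    (2 * Real.pi * Complex.I : ℂ)).sub ((((hS.sub_const (p₀.2 : ℂ)).pow 2).add
    ((hR.sub_const (p.2 : ℂ)).pow 2)).const_mul (Real.pi : ℂ))
  have h' : HasDerivAt (packetPhase R S p₀ p) _ z := h
  rw [h'.deriv]
  simp [hS0, hR0]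

end packetPhase

/-- The wavefront set of a family whose pairings with wave packets are the oscillatory integrals with
phase `packetPhase` is one point. The point `(x₁, r η₀)` is determined by the requirement that `η₀` be
a critical point of the phase on which its real part vanishes. The amplitude `A` is only required to
be holomorphic, with extension `B`, near `η₀`, because the contour is deformed there only. -/
theorem WFh_eq_singleton {Ω : Set ℝ} (hb : Bornology.IsBounded Ω) (hm : MeasurableSet Ω) {η₀ : ℝ}
    (hη₀ : η₀ ∈ interior Ω) {R S : ℂ → ℂ} (hR : Differentiable ℂ R) (hS : Differentiable ℂ S)
    {r s : ℝ → ℝ} (hr : ∀ η : ℝ, R η = r η) (hs : ∀ η : ℝ, S η = s η) {r' s' : ℝ}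
    (hR' : HasDerivAt R r' η₀) (hS' : HasDerivAt S s' η₀) (hr' : r' ≠ 0)
    (hinj : ∀ η ∈ closure Ω, s η = s η₀ → η = η₀)
    (hdom : ∀ η, (η - η₀) ^ 2 ≤ (s η - s η₀) ^ 2 + (r η - r η₀) ^ 2)
    {A : ℝ → ℝ} (hA : Continuous A) (hA0 : A η₀ ≠ 0) {B : ℂ → ℂ} (hB : Differentiable ℂ B)
    (hAB : ∀ᶠ η in 𝓝 η₀, (A η : ℂ) = B (η : ℝ)) {x₀ x₁ : ℝ} (hx : x₁ * r' = x₀ * s')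
    {u : ℝ → ℝ → ℂ}
    (hu : ∀ h : ℝ, 0 < h → ∀ p : ℝ × ℝ, ∫ t : ℝ, u h t * conj (wavePacket h p t) =
      (√(2 / h) : ℂ) * ∫ η in Ω, (A η : ℂ) *
        Complex.exp (packetPhase R S (x₀, s η₀) p η / h)) :
    WFh u = {(x₁, r η₀)} := by
  set p₀ : ℝ × ℝ := (x₀, s η₀) with hp₀
  have hnorm : ∀ h : ℝ, 0 < h → ∀ p : ℝ × ℝ, ‖∫ t : ℝ, u h t * conj (wavePacket h p t)‖ =
      √(2 / h) * ‖∫ η in Ω, (A η : ℂ) * Complex.exp (packetPhase R S p₀ p η / h)‖ := by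
    intro h hh p
    rw [hu h hh p, norm_mul, Complex.norm_real, Real.norm_of_nonneg (Real.sqrt_nonneg _)]
  refine Subset.antisymm (fun p hp => ?_) ?_
  · by_contra hne
    refine hp ?_
    have hle : ∀ η : ℝ, (packetPhase R S p₀ p η).re ≤ 0 := fun η => by
      rw [packetPhase_ofReal_re p₀ p hr hs]
      have : 0 ≤ Real.pi * ((s η - p₀.2) ^ 2 + (r η - p.2) ^ 2) := by positivity
      linarith
    have hlt : ∀ η ∈ closure Ω, η ≠ η₀ → (packetPhase R S p₀ p (η : ℝ)).re < 0 :=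
        fun η hη hne => by
      rw [packetPhase_ofReal_re p₀ p hr hs]
      have h1 : s η - p₀.2 ≠ 0 := sub_ne_zero.mpr fun h => hne (hinj η hη h)
      have : 0 < Real.pi * ((s η - p₀.2) ^ 2 + (r η - p.2) ^ 2) := by positivity
      linarith
    have hcrit : (packetPhase R S p₀ p η₀).re < 0 ∨ (deriv (packetPhase R S p₀ p) η₀).im ≠ 0 := by
      by_cases hξ : p.2 = r η₀
      · right
        rw [deriv_packetPhase p₀ p hR' hS' (by rw [hs]) (by rw [hr, hξ])]
        have e : (2 * Real.pi * Complex.I * (p.1 * r' - p₀.1 * s') : ℂ) =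
            ((2 * Real.pi * (p.1 * r' - p₀.1 * s') : ℝ) : ℂ) * Complex.I := by push_cast; ring
        rw [e, Complex.im_ofReal_mul, Complex.I_im, mul_one]
        refine mul_ne_zero (by positivity) fun h => hne ?_
        rw [hp₀, ← hx, ← sub_mul, mul_eq_zero, or_iff_left hr', sub_eq_zero] at h
        exact Prod.ext h hξ
      · left
        rw [packetPhase_ofReal_re p₀ p hr hs]
        have h1 : r η₀ - p.2 ≠ 0 := sub_ne_zero.mpr (Ne.symm hξ)
        have : 0 < Real.pi * ((s η₀ - p₀.2) ^ 2 + (r η₀ - p.2) ^ 2) := by positivity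
        linarith
    obtain ⟨C, ε, hε, hbd⟩ := exists_eventually_norm_setIntegral_le_of_not_critical
      (continuous_packetPhase p₀ hR.continuous hS.continuous)
      (fun p => differentiable_packetPhase p₀ p hR hS) hb hη₀ hA hB hAB p hle hlt hcrit
    refine microlocallySmall_of_exp_bound hε (C := C) ?_
    filter_upwards [hbd] with p' hp' h hh
    rw [hnorm h hh]
    exact mul_le_mul_of_nonneg_left (hp' h hh) (Real.sqrt_nonneg _)
  · rintro _ rfl ⟨U, hU, hsmall⟩
    set p₁ : ℝ × ℝ := (x₁, r η₀) with hp₁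
    -- smallness of order one at `p₁` itself already contradicts the nonzero limit of the pairings
    obtain ⟨C, hC⟩ := hsmall 1
    have hΨ0 : (packetPhase R S p₀ p₁ η₀).re = 0 := by
      rw [packetPhase_ofReal_re p₀ p₁ hr hs]; simp [hp₀, hp₁]
    obtain ⟨L, hL, hlim⟩ := tendsto_laplace_integral (differentiable_packetPhase p₀ p₁ hR hS)
      (η₀ := η₀) (by
        rw [deriv_packetPhase p₀ p₁ hR' hS' (by rw [hs]) (by rw [hr])]
        have : (x₁ * r' : ℂ) = x₀ * s' := by exact_mod_cast hx
        simp [hp₀, hp₁, this]) (fun η => by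
        rw [Complex.sub_re, hΨ0, sub_zero, packetPhase_ofReal_re p₀ p₁ hr hs]
        have := mul_le_mul_of_nonneg_left (hdom η) Real.pi_pos.le
        simp only [hp₀, hp₁]
        linarith) hb hm hη₀ hA hA0
    have hk2 : Tendsto (fun k : ℝ => k ^ 2) (𝓝[>] 0) (𝓝[>] 0) := by
      refine tendsto_nhdsWithin_iff.mpr ⟨?_, ?_⟩
      · have : Tendsto (fun k : ℝ => k ^ 2) (𝓝 0) (𝓝 (0 ^ 2)) := (continuous_pow 2).tendsto 0
        rw [zero_pow two_ne_zero] at this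
        exact this.mono_left nhdsWithin_le_nhds
      · filter_upwards [self_mem_nhdsWithin] with k hk
        exact pow_pos (mem_Ioi.mp hk) 2
    have hup : Tendsto (fun k : ℝ => C * (k ^ 2) ^ 1) (𝓝[>] 0) (𝓝 0) := by
      have := (hk2.mono_right nhdsWithin_le_nhds).const_mul C
      simpa using this
    have hle : ∀ᶠ k : ℝ in 𝓝[>] 0, √2 * ‖(k⁻¹ : ℂ) * ∫ η in Ω, (A η : ℂ) *
        Complex.exp ((packetPhase R S p₀ p₁ η - packetPhase R S p₀ p₁ η₀) / (k ^ 2 : ℝ))‖ ≤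
        C * (k ^ 2) ^ 1 := by
      filter_upwards [hk2.eventually hC, self_mem_nhdsWithin] with k hk hk0
      have hk0 : 0 < k := hk0
      have h1 := hk p₁ (mem_of_mem_nhds hU)
      rw [hnorm _ (by positivity)] at h1
      refine le_trans (le_of_eq ?_) h1
      have e : ∀ η : ℝ, (A η : ℂ) *
          Complex.exp ((packetPhase R S p₀ p₁ η - packetPhase R S p₀ p₁ η₀) / (k ^ 2 : ℝ)) =
          ((A η : ℂ) * Complex.exp (packetPhase R S p₀ p₁ η / (k ^ 2 : ℝ))) *
          Complex.exp (-(packetPhase R S p₀ p₁ η₀ / (k ^ 2 : ℝ))) := fun η => by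
        rw [mul_assoc, ← Complex.exp_add]
        ring_nf
      simp only [e]
      rw [integral_mul_const, norm_mul, norm_mul, Complex.norm_exp, Complex.neg_re,
        Complex.div_ofReal_re, hΨ0, norm_inv, Complex.norm_real, Real.norm_of_nonneg hk0.le,
        Real.sqrt_div zero_le_two, Real.sqrt_sq hk0.le]
      simp only [zero_div, neg_zero, Real.exp_zero, mul_one]
      ring
    have h0 := le_of_tendsto_of_tendsto (hlim.norm.const_mul √2) hup hle
    have : 0 < √2 * ‖L‖ := by positivity
    linarith

/-! ### The phase shift function -/

/-- The normalized phase shift function as an entire function. -/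
noncomputable def Scheme.phaseExt (D : Scheme) (z : ℂ) : ℂ :=
  1 / (2 * Real.pi * Complex.I) *
    ∑ n ∈ D.nodes, D.coeff n * Complex.exp (2 * Real.pi * Complex.I * n * z)

theorem Scheme.differentiable_phaseExt (D : Scheme) : Differentiable ℂ D.phaseExt := by
  unfold Scheme.phaseExt
  fun_prop

theorem Scheme.RealPhase.phaseExt_ofReal {D : Scheme} (hD : D.RealPhase) (η : ℝ) :
    D.phaseExt η = D.q₀ η :=
  (hD.coe_q₀ η).symm

theorem Scheme.hasDerivAt_q₀ (D : Scheme) (η : ℝ) :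
    HasDerivAt D.q₀ (deriv D.phaseExt η).re η :=
  (D.differentiable_phaseExt η).hasDerivAt.real_of_complex

theorem Scheme.continuous_q₀ (D : Scheme) : Continuous D.q₀ :=
  continuous_iff_continuousAt.mpr fun η => (D.hasDerivAt_q₀ η).continuousAt

theorem Scheme.continuous_deriv_q₀ (D : Scheme) : Continuous (deriv D.q₀) := by
  have h : deriv D.q₀ = fun η : ℝ => (deriv D.phaseExt η).re :=
    funext fun η => (D.hasDerivAt_q₀ η).deriv
  rw [h]
  exact Complex.continuous_re.comp
    (((D.differentiable_phaseExt.contDiff (n := 1)).continuous_deriv le_rfl).comp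
      Complex.continuous_ofReal)

theorem Scheme.RealPhase.hasDerivAt_phaseExt {D : Scheme} (hD : D.RealPhase) (η : ℝ) :
    HasDerivAt D.phaseExt (deriv D.q₀ η : ℝ) η := by
  have h1 := (D.differentiable_phaseExt η).hasDerivAt
  have h2 := h1.comp_ofReal
  have h3 : HasDerivAt (fun y : ℝ => D.phaseExt y) ((deriv D.q₀ η : ℝ) : ℂ) η := by
    have h4 := (D.hasDerivAt_q₀ η).differentiableAt.hasDerivAt.ofReal_comp
    refine h4.congr_of_eventuallyEq (Eventually.of_forall fun y => hD.phaseExt_ofReal y)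
  rwa [h2.unique h3] at h1

theorem Scheme.hasDerivAt_q (D : Scheme) {h : ℝ} (hh : h ≠ 0) (ω : ℝ) :
    HasDerivAt (D.q h) (deriv D.q₀ (ω * h)) ω := by
  have e : D.q h = fun ω => D.q₀ (ω * h) / h := funext fun ω => D.q_eq ω
  rw [e]
  have h1 := (D.hasDerivAt_q₀ (ω * h)).differentiableAt.hasDerivAt
  have h2 := (h1.comp ω ((hasDerivAt_id ω).mul_const h)).div_const h
  convert! h2 using 1
  field_simp

theorem Scheme.IsBand.injOn_q {D : Scheme} {Ω₀ : Set ℝ} (hΩ : D.IsBand Ω₀) {h : ℝ} (hh : h ≠ 0) :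
    InjOn (D.q h) (band Ω₀ h) := fun ω hω ω' hω' he => by
  rw [D.q_eq, D.q_eq, div_left_inj' hh] at he
  exact mul_right_cancel₀ hh (hΩ.injOn hω hω' he)

/-- A continuous injective function on an interval moves monotonically away from its value at `a`. -/
theorem abs_sub_le_of_injOn {f : ℝ → ℝ} (hf : Continuous f) {s : Set ℝ} (hs : s.OrdConnected)
    (hinj : InjOn f s) {a b c : ℝ} (ha : a ∈ s) (hb : b ∈ s) (hc : c ∈ uIcc a b) :
    |f c - f a| ≤ |f b - f a| := by
  have hi : InjOn f (uIcc a b) := hinj.mono (hs.uIcc_subset ha hb)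
  have key : ∀ x y : ℝ, x ≤ y → InjOn f (Icc x y) → c ∈ Icc x y →
      f x ≤ f c ∧ f c ≤ f y ∨ f y ≤ f c ∧ f c ≤ f x := fun x y hxy hi hc => by
    rcases hf.continuousOn.strictMonoOn_of_injOn_Icc' hxy hi with h | h
    · exact Or.inl ⟨h.monotoneOn (left_mem_Icc.mpr hxy) hc hc.1,
        h.monotoneOn hc (right_mem_Icc.mpr hxy) hc.2⟩
    · exact Or.inr ⟨h.antitoneOn hc (right_mem_Icc.mpr hxy) hc.2,
        h.antitoneOn (left_mem_Icc.mpr hxy) hc hc.1⟩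
  rcases le_total a b with hab | hab
  · rw [uIcc_of_le hab] at hi hc
    rcases key a b hab hi hc with ⟨h1, h2⟩ | ⟨h1, h2⟩
    · rw [abs_of_nonneg (by linarith), abs_of_nonneg (by linarith)]; linarith
    · rw [abs_of_nonpos (by linarith), abs_of_nonpos (by linarith)]; linarith
  · rw [uIcc_of_ge hab] at hi hc
    rcases key b a hab hi hc with ⟨h1, h2⟩ | ⟨h1, h2⟩
    · rw [abs_of_nonpos (by linarith), abs_of_nonpos (by linarith)]; linarith
    · rw [abs_of_nonneg (by linarith), abs_of_nonneg (by linarith)]; linarith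

/-- The value of `q₀` at a point of the band is not attained at any other point of the closed band,
though `q₀` is assumed injective only on the band itself. -/
theorem Scheme.IsBand.eq_of_mem_closure {D : Scheme} {Ω₀ : Set ℝ} (hΩ : D.IsBand Ω₀) {η₀ η : ℝ}
    (hη₀ : η₀ ∈ Ω₀) (hη : η ∈ closure Ω₀) (he : D.q₀ η = D.q₀ η₀) : η = η₀ := by
  by_contra hne
  -- frequencies close to `η` lie beyond the midpoint of `η₀` and `η`
  set c : ℝ := (η₀ + η) / 2 with hc
  have hcne : c ≠ η₀ := fun h => hne (by rw [hc] at h; linarith)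
  have hev : ∀ᶠ y in 𝓝 η, c ∈ uIcc η₀ y := by
    rcases lt_or_gt_of_ne hne with h | h
    · filter_upwards [Iio_mem_nhds (show η < c by rw [hc]; linarith)] with y hy
      rw [mem_Iio] at hy
      exact mem_uIcc.mpr (Or.inr ⟨hy.le, by rw [hc]; linarith⟩)
    · filter_upwards [Ioi_mem_nhds (show c < η by rw [hc]; linarith)] with y hy
      rw [mem_Ioi] at hy
      exact mem_uIcc.mpr (Or.inl ⟨by rw [hc]; linarith, hy.le⟩)
  obtain ⟨y₀, hy₀, hy₀Ω⟩ := mem_closure_iff_nhds.mp hη _ hev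
  have hcΩ : c ∈ Ω₀ := hΩ.ordConnected.uIcc_subset hη₀ hy₀Ω hy₀
  have hpos : 0 < |D.q₀ c - D.q₀ η₀| :=
    abs_pos.mpr (sub_ne_zero.mpr fun h => hcne (hΩ.injOn hcΩ hη₀ h))
  have hlim : ∀ᶠ y in 𝓝 η, |D.q₀ y - D.q₀ η₀| < |D.q₀ c - D.q₀ η₀| := by
    have hcont : ContinuousAt (fun y => |D.q₀ y - D.q₀ η₀|) η :=
      ((D.continuous_q₀.sub continuous_const).abs).continuousAt
    refine hcont.eventually_lt continuousAt_const ?_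
    simpa [he] using hpos
  obtain ⟨y, ⟨hy1, hy2⟩, hyΩ⟩ := mem_closure_iff_nhds.mp hη _ (hev.and hlim)
  exact absurd (abs_sub_le_of_injOn D.continuous_q₀ hΩ.ordConnected hΩ.injOn hη₀ hyΩ hy1)
    (not_le.mpr hy2)

/-- Simultaneous recurrence of finitely many frequencies. -/
theorem exists_seq_tendsto_exp_one (Z : Finset ℝ) : ∃ m : ℕ → ℝ, (∀ j, 1 ≤ m j) ∧
    ∀ n ∈ Z, Tendsto (fun j => Complex.exp (2 * Real.pi * Complex.I * n * m j)) atTop (𝓝 1) := by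
  set x : ℕ → Z → ℂ := fun k n => Complex.exp (((2 * Real.pi * n * k : ℝ) : ℂ) * Complex.I) with hx
  have hx1 : ∀ k n, ‖x k n‖ = 1 := fun k n => Complex.norm_exp_ofReal_mul_I _
  obtain ⟨a, -, φ, hφ, ha⟩ := tendsto_subseq_of_bounded (x := x)
    (Metric.isBounded_closedBall (x := (0 : Z → ℂ)) (r := 1)) fun k => by
      rw [mem_closedBall_zero_iff, pi_norm_le_iff_of_nonneg zero_le_one]
      exact fun n => (hx1 k n).le
  -- differences of consecutive times of a convergent subsequence of the torus rotation
  refine ⟨fun j => φ (j + 1) - φ j, fun j => ?_, fun n hn => ?_⟩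
  · have : φ j + 1 ≤ φ (j + 1) := hφ (Nat.lt_succ_self j)
    have : (φ j : ℝ) + 1 ≤ φ (j + 1) := by exact_mod_cast this
    linarith
  · have h1 : Tendsto (fun j => x (φ j) ⟨n, hn⟩) atTop (𝓝 (a ⟨n, hn⟩)) :=
      (tendsto_pi_nhds.mp ha) ⟨n, hn⟩
    have hna : ‖a ⟨n, hn⟩‖ = 1 := by
      refine tendsto_nhds_unique h1.norm ?_
      simp only [hx1]
      exact tendsto_const_nhds
    have ha0 : a ⟨n, hn⟩ ≠ 0 := fun h => by simp [h] at hna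
    have h2 := (h1.comp (tendsto_add_atTop_nat 1)).div h1 ha0
    rw [div_self ha0] at h2
    refine h2.congr fun j => ?_
    simp only [hx, Function.comp, Pi.div_apply, ← Complex.exp_sub]
    congr 1
    push_cast
    ring

/-- A band is bounded: on an unbounded band the phase shift function would be strictly monotone,
which contradicts its almost periodicity. -/
theorem Scheme.IsBand.isBounded {D : Scheme} {Ω₀ : Set ℝ} (hΩ : D.IsBand Ω₀) :
    Bornology.IsBounded Ω₀ := by
  obtain ⟨m, hm1, hm⟩ := exists_seq_tendsto_exp_one D.nodes
  have hlim : ∀ σ : ℝ, σ = 1 ∨ σ = -1 →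
      Tendsto (fun j => D.q₀ (σ * m j)) atTop (𝓝 (D.q₀ 0)) := fun σ hσ => by
    refine (Complex.continuous_re.tendsto _).comp (Tendsto.const_mul _ ?_)
    refine tendsto_finsetSum _ fun n hn => Tendsto.const_mul _ ?_
    have h1 := hm n hn
    simp only [Complex.ofReal_zero, mul_zero, Complex.exp_zero]
    rcases hσ with rfl | rfl
    · simpa using h1
    · have h2 := h1.inv₀ one_ne_zero
      rw [inv_one] at h2
      refine h2.congr fun j => ?_
      rw [← Complex.exp_neg]
      push_cast
      ring_nf
  have hclose : ∀ σ : ℝ, σ = 1 ∨ σ = -1 →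
      ∀ᶠ j in atTop, σ ∈ Ω₀ → |D.q₀ (σ * m j) - D.q₀ 0| < |D.q₀ σ - D.q₀ 0| := fun σ hσ => by
    by_cases hσΩ : σ ∈ Ω₀
    · have hσ0 : σ ≠ 0 := by rcases hσ with rfl | rfl <;> norm_num
      have hpos : 0 < |D.q₀ σ - D.q₀ 0| :=
        abs_pos.mpr (sub_ne_zero.mpr fun h => hσ0 (hΩ.injOn hσΩ hΩ.zero_mem h))
      have h1 := ((hlim σ hσ).sub_const (D.q₀ 0)).abs
      rw [sub_self, abs_zero] at h1
      filter_upwards [h1.eventually (gt_mem_nhds hpos)] with j hj _ using hj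
    · exact Eventually.of_forall fun _ h => absurd h hσΩ
  -- `m j ≥ 1` is so good a recurrence time that neither `m j` nor `-m j` can lie in the band
  obtain ⟨j, hj1, hj2⟩ := ((hclose 1 (Or.inl rfl)).and (hclose (-1) (Or.inr rfl))).exists
  have hnot : ∀ σ : ℝ, σ = 1 ∨ σ = -1 →
      (σ ∈ Ω₀ → |D.q₀ (σ * m j) - D.q₀ 0| < |D.q₀ σ - D.q₀ 0|) → σ * m j ∉ Ω₀ := by
    intro σ hσ hlt hmem
    have hmj := hm1 j
    have hin : σ ∈ uIcc 0 (σ * m j) := by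
      rcases hσ with rfl | rfl
      · exact mem_uIcc.mpr (Or.inl ⟨by norm_num, by linarith⟩)
      · exact mem_uIcc.mpr (Or.inr ⟨by linarith, by norm_num⟩)
    exact absurd (abs_sub_le_of_injOn D.continuous_q₀ hΩ.ordConnected hΩ.injOn hΩ.zero_mem hmem hin)
      (not_le.mpr (hlt (hΩ.ordConnected.uIcc_subset hΩ.zero_mem hmem hin)))
  have hn1 := hnot 1 (Or.inl rfl) hj1
  have hn2 := hnot (-1) (Or.inr rfl) hj2
  have hmj := hm1 j
  refine (Metric.isBounded_Icc (-m j) (m j)).subset fun y hy => ?_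
  have hsub := hΩ.ordConnected.uIcc_subset hΩ.zero_mem hy
  constructor
  · by_contra! hlt
    exact hn2 (hsub (mem_uIcc.mpr (Or.inr ⟨by linarith, by linarith⟩)))
  · by_contra! hlt
    exact hn1 (hsub (mem_uIcc.mpr (Or.inl ⟨by linarith, by linarith⟩)))

/-! ### The transforms of a wave packet -/

theorem norm_fourier_wavePacket_le {h : ℝ} (hh : 0 < h) (p : ℝ × ℝ) (ω : ℝ) :
    ‖𝓕 (wavePacket h p) ω‖ ≤ (2 / h) ^ (1 / 4 : ℝ) * h ^ (1 / 2 : ℝ) := by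
  have e : (-2 * Real.pi * Complex.I * p.1 * ω - Real.pi * (h * ω - p.2) ^ 2 / h : ℂ) =
      ((-2 * Real.pi * p.1 * ω : ℝ) : ℂ) * Complex.I +
        ((-(Real.pi * (h * ω - p.2) ^ 2 / h) : ℝ) : ℂ) := by
    push_cast; ring
  rw [fourier_wavePacket hh, norm_mul, Complex.norm_real, Real.norm_of_nonneg (by positivity),
    Complex.norm_exp]
  refine mul_le_of_le_one_right (by positivity) (Real.exp_le_one_iff.mpr ?_)
  rw [e, Complex.add_re, Complex.re_ofReal_mul, Complex.I_re, mul_zero, zero_add,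
    Complex.ofReal_re, neg_nonpos]
  positivity

theorem continuous_fourier_wavePacket {h : ℝ} (hh : 0 < h) (p : ℝ × ℝ) :
    Continuous (𝓕 (wavePacket h p)) := by
  rw [show 𝓕 (wavePacket h p) = _ from funext fun ω => fourier_wavePacket hh p ω]
  fun_prop

/-- The integrand of the pairing in the frequency variable `η`; the factor `h` cancels against the
Jacobian of `η = ω h`. -/
theorem fourier_wavePacket_mul_conj {R S : ℂ → ℂ} {r s : ℝ → ℝ} (hr : ∀ η : ℝ, R η = r η)
    (hs : ∀ η : ℝ, S η = s η) {h : ℝ} (hh : 0 < h) (p₀ p : ℝ × ℝ) (η : ℝ) :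
    𝓕 (wavePacket h p₀) (s η / h) * conj (𝓕 (wavePacket h p) (r η / h)) =
      h * (√(2 / h) : ℂ) * Complex.exp (packetPhase R S p₀ p η / h) := by
  have hh' : (h : ℂ) ≠ 0 := by exact_mod_cast hh.ne'
  have hc : ((2 / h) ^ (1 / 4 : ℝ) * h ^ (1 / 2 : ℝ)) * ((2 / h) ^ (1 / 4 : ℝ) * h ^ (1 / 2 : ℝ)) =
      h * √(2 / h) := by
    have h1 : h ^ (1 / 2 : ℝ) * h ^ (1 / 2 : ℝ) = h := by
      rw [← Real.sqrt_eq_rpow, Real.mul_self_sqrt hh.le]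
    have h2 := rpow_quarter_sq (x := 2 / h) (by positivity)
    rw [mul_mul_mul_comm, h1, ← sq, h2, mul_comm]
  rw [fourier_wavePacket hh, fourier_wavePacket hh, map_mul, Complex.conj_ofReal, mul_mul_mul_comm,
    ← Complex.ofReal_mul, hc, ← Complex.exp_conj, ← Complex.exp_add, Complex.ofReal_mul]
  congr 2
  rw [packetPhase, hr, hs]
  simp only [map_sub, map_mul, map_neg, map_div₀, map_pow, Complex.conj_I, Complex.conj_ofReal,
    map_ofNat]
  push_cast
  field_simp
  ring

theorem setIntegral_band (Ω₀ : Set ℝ) (hm : MeasurableSet Ω₀) {h : ℝ} (hh : 0 < h) (F : ℝ → ℂ) :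
    ∫ ω in band Ω₀ h, F (ω * h) = (h⁻¹ : ℂ) * ∫ η in Ω₀, F η := by
  have hmb : MeasurableSet (band Ω₀ h) :=
    (measurable_id.mul_const h : Measurable fun ω : ℝ => ω * h) hm
  rw [← integral_indicator hmb, ← integral_indicator hm]
  have e : (band Ω₀ h).indicator (fun ω => F (ω * h)) = fun ω => Ω₀.indicator F (ω * h) := rfl
  rw [e, Measure.integral_comp_mul_right, abs_of_pos (inv_pos.mpr hh), Complex.real_smul,
    Complex.ofReal_inv]

theorem Scheme.IsBand.measurableSet {D : Scheme} {Ω₀ : Set ℝ} (hΩ : D.IsBand Ω₀) :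
    MeasurableSet Ω₀ := hΩ.ordConnected.measurableSet

theorem Scheme.IsBand.measurableSet_band {D : Scheme} {Ω₀ : Set ℝ} (hΩ : D.IsBand Ω₀)
    (h : ℝ) : MeasurableSet (band Ω₀ h) :=
  (measurable_id.mul_const h : Measurable fun ω : ℝ => ω * h) hΩ.measurableSet

theorem Scheme.IsBand.isBounded_band {D : Scheme} {Ω₀ : Set ℝ} (hΩ : D.IsBand Ω₀)
    {h : ℝ} (hh : 0 < h) : Bornology.IsBounded (band Ω₀ h) := by
  obtain ⟨C, hC⟩ := hΩ.isBounded.exists_norm_le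
  refine (Metric.isBounded_closedBall (x := (0 : ℝ)) (r := C / h)).subset fun ω hω => ?_
  have := hC _ hω
  rw [norm_mul, Real.norm_of_nonneg hh.le] at this
  rwa [mem_closedBall_zero_iff, le_div_iff₀ hh]

theorem Scheme.IsBand.integrableOn_band {D : Scheme} {Ω₀ : Set ℝ} (hΩ : D.IsBand Ω₀)
    {h : ℝ} (hh : 0 < h) {g : ℝ → ℂ} (hg : Continuous g) :
    IntegrableOn g (band Ω₀ h) :=
  (hg.continuousOn.integrableOn_compact (hΩ.isBounded_band hh).isCompact_closure).mono_set
    subset_closure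

theorem Scheme.IsBand.measurableSet_image_q {D : Scheme} {Ω₀ : Set ℝ} (hΩ : D.IsBand Ω₀)
    {h : ℝ} (hh : 0 < h) : MeasurableSet (D.q h '' band Ω₀ h) :=
  (hΩ.measurableSet_band h).image_of_continuousOn_injOn
    (fun ω _ => (D.hasDerivAt_q hh.ne' ω).continuousAt.continuousWithinAt) (hΩ.injOn_q hh.ne')

theorem Scheme.IsBand.qInv_q {D : Scheme} {Ω₀ : Set ℝ} (hΩ : D.IsBand Ω₀)
    {h : ℝ} (hh : 0 < h) {ω : ℝ} (hω : ω ∈ band Ω₀ h) : D.qInv Ω₀ h (D.q h ω) = ω :=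
  (hΩ.injOn_q hh.ne').leftInvOn_invFunOn hω

theorem Scheme.IsBand.integrableOn_fourier_comp_qInv {D : Scheme} {Ω₀ : Set ℝ} (hΩ : D.IsBand Ω₀)
    {h : ℝ} (hh : 0 < h) (p : ℝ × ℝ) :
    IntegrableOn (fun ω => 𝓕 (wavePacket h p) (D.qInv Ω₀ h ω)) (D.q h '' band Ω₀ h) := by
  rw [integrableOn_image_iff_integrableOn_abs_deriv_smul (hΩ.measurableSet_band h)
    (fun ω _ => (D.hasDerivAt_q hh.ne' ω).hasDerivWithinAt) (hΩ.injOn_q hh.ne')]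
  have hc : Continuous fun ω => |deriv D.q₀ (ω * h)| • 𝓕 (wavePacket h p) ω := by
    have h1 := D.continuous_deriv_q₀
    have h2 := continuous_fourier_wavePacket hh p
    fun_prop
  refine (hΩ.integrableOn_band hh hc).congr_fun (fun ω hω => ?_) (hΩ.measurableSet_band h)
  simp only [hΩ.qInv_q hh hω]

theorem Scheme.continuous_fourier_comp_q (D : Scheme) {h : ℝ} (hh : 0 < h) (p : ℝ × ℝ) :
    Continuous fun ω => 𝓕 (wavePacket h p) (D.q h ω) :=
  (continuous_fourier_wavePacket hh p).comp
    (continuous_iff_continuousAt.mpr fun ω => (D.hasDerivAt_q hh.ne' ω).continuousAt)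

theorem Scheme.IsBand.memLp_ITDT {D : Scheme} {Ω₀ : Set ℝ} (hΩ : D.IsBand Ω₀)
    {h : ℝ} (hh : 0 < h) (p : ℝ × ℝ) :
    MemLp (D.ITDT Ω₀ h (wavePacket h p)) 2 volume :=
  memLp_two_setIntegral_exp_mul (hΩ.measurableSet_image_q hh)
    (hΩ.integrableOn_fourier_comp_qInv hh p) fun _ _ => norm_fourier_wavePacket_le hh p _

theorem Scheme.IsBand.memLp_FTDT {D : Scheme} {Ω₀ : Set ℝ} (hΩ : D.IsBand Ω₀)
    {h : ℝ} (hh : 0 < h) (p : ℝ × ℝ) :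
    MemLp (D.FTDT Ω₀ h (wavePacket h p)) 2 volume :=
  memLp_two_setIntegral_exp_mul (hΩ.measurableSet_band h)
    (hΩ.integrableOn_band hh (D.continuous_fourier_comp_q hh p))
    fun _ _ => norm_fourier_wavePacket_le hh p _

/-- In the frequency variable `η` of the band the pairing of the inverse transform has amplitude
`|q₀'|`, the Jacobian of the substitution `ω = q₀(η) / h`, so that `q₀⁻¹` no longer occurs. -/
theorem Scheme.IsBand.integral_ITDT_mul_conj_wavePacket {D : Scheme} {Ω₀ : Set ℝ}
    (hΩ : D.IsBand Ω₀) {h : ℝ} (hh : 0 < h) (hD : D.RealPhase) (p₀ p : ℝ × ℝ) :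
    ∫ t : ℝ, D.ITDT Ω₀ h (wavePacket h p₀) t * conj (wavePacket h p t) =
      (√(2 / h) : ℂ) * ∫ η in Ω₀, ((|deriv D.q₀ η| : ℝ) : ℂ) *
        Complex.exp (packetPhase D.phaseExt id p₀ p η / h) := by
  have hh' : (h : ℂ) ≠ 0 := by exact_mod_cast hh.ne'
  have h1 := integral_setIntegral_exp_mul_conj_wavePacket (hΩ.measurableSet_image_q hh)
    (hΩ.integrableOn_fourier_comp_qInv hh p₀) hh p
  rw [integral_image_eq_integral_abs_deriv_smul (hΩ.measurableSet_band h)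
    (fun ω _ => (D.hasDerivAt_q hh.ne' ω).hasDerivWithinAt) (hΩ.injOn_q hh.ne')] at h1
  refine h1.trans ?_
  have h2 : ∀ ω ∈ band Ω₀ h, |deriv D.q₀ (ω * h)| •
      (𝓕 (wavePacket h p₀) (D.qInv Ω₀ h (D.q h ω)) * conj (𝓕 (wavePacket h p) (D.q h ω))) =
      (fun η : ℝ => (h * (√(2 / h) : ℂ)) * (((|deriv D.q₀ η| : ℝ) : ℂ) *
        Complex.exp (packetPhase D.phaseExt id p₀ p η / h))) (ω * h) := fun ω hω => by
    have h3 := fourier_wavePacket_mul_conj (S := id) (s := id) hD.phaseExt_ofReal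
      (fun _ => rfl) hh p₀ p (ω * h)
    rw [id, mul_div_cancel_right₀ _ hh.ne', ← D.q_eq] at h3
    rw [hΩ.qInv_q hh hω, h3, Complex.real_smul]
    ring
  rw [setIntegral_congr_fun (hΩ.measurableSet_band h) h2,
    setIntegral_band Ω₀ hΩ.measurableSet hh (fun η : ℝ => (h * (√(2 / h) : ℂ)) *
      (((|deriv D.q₀ η| : ℝ) : ℂ) * Complex.exp (packetPhase D.phaseExt id p₀ p η / h))),
    integral_const_mul]
  field_simp

theorem Scheme.IsBand.integral_FTDT_mul_conj_wavePacket {D : Scheme} {Ω₀ : Set ℝ}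
    (hΩ : D.IsBand Ω₀) {h : ℝ} (hh : 0 < h) (hD : D.RealPhase) (p₀ p : ℝ × ℝ) :
    ∫ t : ℝ, D.FTDT Ω₀ h (wavePacket h p₀) t * conj (wavePacket h p t) =
      (√(2 / h) : ℂ) * ∫ η in Ω₀, Complex.exp (packetPhase id D.phaseExt p₀ p η / h) := by
  have hh' : (h : ℂ) ≠ 0 := by exact_mod_cast hh.ne'
  refine (integral_setIntegral_exp_mul_conj_wavePacket (hΩ.measurableSet_band h)
    (hΩ.integrableOn_band hh (D.continuous_fourier_comp_q hh p₀)) hh p).trans ?_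
  have h2 : ∀ ω ∈ band Ω₀ h,
      𝓕 (wavePacket h p₀) (D.q h ω) * conj (𝓕 (wavePacket h p) ω) =
      (fun η : ℝ => (h * (√(2 / h) : ℂ)) *
        Complex.exp (packetPhase id D.phaseExt p₀ p η / h)) (ω * h) := fun ω _ => by
    have h3 := fourier_wavePacket_mul_conj (R := id) (r := id) (fun _ => rfl) hD.phaseExt_ofReal
      hh p₀ p (ω * h)
    rwa [id, mul_div_cancel_right₀ _ hh.ne', ← D.q_eq] at h3
  rw [setIntegral_congr_fun (hΩ.measurableSet_band h) h2,
    setIntegral_band Ω₀ hΩ.measurableSet hh (fun η : ℝ => (h * (√(2 / h) : ℂ)) *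
      Complex.exp (packetPhase id D.phaseExt p₀ p η / h)),
    integral_const_mul]
  field_simp

/-- The case `r = q₀`, `s = id`, `A = |q₀'|` of `WFh_eq_singleton`. -/
theorem Scheme.IsBand.WFh_ITDT {D : Scheme} {Ω₀ : Set ℝ} (hΩ : D.IsBand Ω₀) (hD : D.RealPhase)
    (x₀ : ℝ) {ξ₀ : ℝ} (hξ₀ : ξ₀ ∈ interior Ω₀) (hd : deriv D.q₀ ξ₀ ≠ 0) :
    WFh (fun h => D.ITDT Ω₀ h (wavePacket h (x₀, ξ₀))) = {D.chi (x₀, ξ₀)} := by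
  -- near `ξ₀` the sign of `q₀'` is constant, so that `|q₀'|` extends holomorphically
  obtain ⟨σ, hσ⟩ : ∃ σ : ℝ, ∀ᶠ η in 𝓝 ξ₀, |deriv D.q₀ η| = σ * deriv D.q₀ η := by
    rcases hd.lt_or_gt with h | h
    · refine ⟨-1, ?_⟩
      filter_upwards [D.continuous_deriv_q₀.continuousAt.eventually_lt continuousAt_const h]
        with η hη
      rw [abs_of_neg hη, neg_one_mul]
    · refine ⟨1, ?_⟩
      filter_upwards [continuousAt_const.eventually_lt D.continuous_deriv_q₀.continuousAt h]
        with η hη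
      rw [abs_of_pos hη, one_mul]
  have hB : Differentiable ℂ fun z => (σ : ℂ) * deriv D.phaseExt z :=
    ((D.differentiable_phaseExt.contDiff (n := 2)).differentiable_deriv_two).const_mul _
  refine WFh_eq_singleton (S := id) (s := id) (s' := 1) hΩ.isBounded hΩ.measurableSet hξ₀
    D.differentiable_phaseExt differentiable_id hD.phaseExt_ofReal (fun _ => rfl)
    (hD.hasDerivAt_phaseExt ξ₀) (by simpa using hasDerivAt_id (ξ₀ : ℂ)) hd (fun η _ h => h)
    (fun η => ?_) (A := fun η => |deriv D.q₀ η|) D.continuous_deriv_q₀.abs (abs_ne_zero.mpr hd)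
    hB ?_ (x₀ := x₀) (by field_simp) fun h hh p =>
      hΩ.integral_ITDT_mul_conj_wavePacket hh hD (x₀, ξ₀) p
  · simp only [id]
    nlinarith [sq_nonneg (D.q₀ η - D.q₀ ξ₀)]
  · filter_upwards [hσ] with η hη
    rw [hη, (hD.hasDerivAt_phaseExt η).deriv, Complex.ofReal_mul]

/-- The case `r = id`, `s = q₀`, `A = 1` of `WFh_eq_singleton`. The derivative `q₀'(η₀)` may vanish
here. -/
theorem Scheme.IsBand.WFh_FTDT {D : Scheme} {Ω₀ : Set ℝ} (hΩ : D.IsBand Ω₀) (hD : D.RealPhase)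
    (x₀ : ℝ) {η₀ : ℝ} (hη₀ : η₀ ∈ interior Ω₀) :
    WFh (fun h => D.FTDT Ω₀ h (wavePacket h (x₀, D.q₀ η₀))) = {D.chiInv Ω₀ (x₀, D.q₀ η₀)} := by
  rw [Scheme.chiInv_apply hΩ x₀ (interior_subset hη₀)]
  refine WFh_eq_singleton (R := id) (r := id) (r' := 1) hΩ.isBounded hΩ.measurableSet hη₀
    differentiable_id D.differentiable_phaseExt (fun _ => rfl) hD.phaseExt_ofReal
    (by simpa using hasDerivAt_id (η₀ : ℂ)) (hD.hasDerivAt_phaseExt η₀) one_ne_zero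
    (fun η hη h => hΩ.eq_of_mem_closure (interior_subset hη₀) hη h)
    (fun η => ?_) (A := fun _ => 1) continuous_const one_ne_zero (B := fun _ => 1)
    (differentiable_const _) (Eventually.of_forall fun _ => Complex.ofReal_one)
    (x₀ := x₀) (mul_one _) fun h hh p => ?_
  · simp only [id]
    nlinarith [sq_nonneg (D.q₀ η - D.q₀ η₀)]
  · simpa only [Complex.ofReal_one, one_mul] using
      hΩ.integral_FTDT_mul_conj_wavePacket hh hD (x₀, D.q₀ η₀) p

end TimeDispersion

open TimeDispersion in
theorem mainTheorem5 (D : Scheme) (hD : D.RealPhase) (Ω₀ : Set ℝ) (hΩ : D.IsBand Ω₀) :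
    (∀ x₀ ξ₀ : ℝ, ξ₀ ∈ interior Ω₀ → deriv D.q₀ ξ₀ ≠ 0 →
      (∀ h > 0, MemLp (D.ITDT Ω₀ h (wavePacket h (x₀, ξ₀))) 2 volume) ∧
      WFh (fun h => D.ITDT Ω₀ h (wavePacket h (x₀, ξ₀))) = {D.chi (x₀, ξ₀)} ∧
      D.chi (x₀, ξ₀) = (x₀ / deriv D.q₀ ξ₀, D.q₀ ξ₀)) ∧
    (∀ x₀ ξ₀ : ℝ, ξ₀ ∈ D.q₀ '' interior Ω₀ →
      (∀ h > 0, MemLp (D.FTDT Ω₀ h (wavePacket h (x₀, ξ₀))) 2 volume) ∧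
      WFh (fun h => D.FTDT Ω₀ h (wavePacket h (x₀, ξ₀))) = {D.chiInv Ω₀ (x₀, ξ₀)} ∧
      D.chiInv Ω₀ (x₀, ξ₀) =
        (x₀ * deriv D.q₀ (D.q₀Inv Ω₀ ξ₀), D.q₀Inv Ω₀ ξ₀)) := by
  refine ⟨fun x₀ ξ₀ hξ₀ hd => ⟨fun h hh => hΩ.memLp_ITDT hh _, hΩ.WFh_ITDT hD x₀ hξ₀ hd, rfl⟩, ?_⟩
  rintro x₀ _ ⟨η₀, hη₀, rfl⟩
  exact ⟨fun h hh => hΩ.memLp_FTDT hh _, hΩ.WFh_FTDT hD x₀ hη₀, rfl⟩
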